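/- There is an absolute constant $C>0$ such that the following holds. Setting. Let $n\in\{0,1,2,\dots\}\cup\{\infty\}$, $\mathcal X$ a finite nonempty set of states, $m\ge 1$ an integer, $\mathcal A_{\mathrm{full}}(x)$ a set of actions for each $x\in\mathcal X$, and $\phi(x,a)\in\mathbb R^n$ a feature vector for each $x\in\mathcal X$, $a\in\mathcal A_{\mathrm{full}}(x)$, with $\sum_i\phi_i(x,a)^2<\infty$. Let $\theta\sim\mathcal N(0,I)$ in $\mathbb R^n$ (independent standard normal coordinates) and $$Q^*(x,a)=\langle\theta,\phi(x,a)\rangle=\sum_i\theta_i\phi_i(x,a).$$ If $n=\infty$, assume that almost surely these series converge for all $x\in\mathcal X$, $a\in\mathcal A_{\mathrm{full}}(x)$ simultaneously. Let $\Theta_1,\dots,\Theta_m$ be sets of values of $\theta$ for which all these series converge (for instance, when $n<\infty$, the cells of a partition of $\mathbb R^n$), and define the clusters $$r_{x,\ell}=\Big\{a\in\mathcal A_{\mathrm{full}}(x)\;:\;\exists\,\theta\in\Theta_\ell,\ a\in\operatorname*{arg\,max}_{b\in\mathcal A_{\mathrm{full}}(x)}\langle\theta,\phi(x,b)\rangle\Big\}.$$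 Assume that each set $\phi(x,r_{x,\ell})=\{\phi(x,a):a\in r_{x,\ell}\}$ is compact in the Euclidean ($\ell^2$) norm and, if $n=\infty$, that almost surely $\sup_{a\in r_{x,\ell}}Q^*(x,a)<\infty$ for all $x,\ell$ (which is automatic for $n<\infty$). Choose any representative $a_{x,\ell}\in r_{x,\ell}$ for each $x,\ell$ (so that clusters are nonempty), and put $$Y_{x,\ell}=\sup_{a\in r_{x,\ell}}\big(Q^*(x,a)-Q^*(x,a_{x,\ell})\big),\qquad G(r_{x,\ell})=\mathbb E_{u\sim\mathcal N(0,I)}\sup_{a\in r_{x,\ell}}\langle u,\phi(x,a)\rangle,$$ $$\epsilon=\max_{x\in\mathcal X,\ \ell\le m}\ \sup_{a,b\in r_{x,\ell}}\|\phi(x,a)-\phi(x,b)\|_2 .$$ Conclusion. The variables $\sup_{a\in r_{x,\ell}}\langle u,\phi(x,a)\rangle$, $\max_{x,\ell}Y_{x,\ell}$ and $\max_x\min_\ell Y_{x,\ell}$ are integrable, and $$\mathbb E_\theta\Big[\max_{x\in\mathcal X,\ \ell\le m}Y_{x,\ell}\Big]\le\max_{x\in\mathcal X,\ \ell\le m}G(r_{x,\ell})+C\,\epsilon\,\sqrt{\log(m|\mathcal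 X|)},$$ $$\mathbb E_\theta\Big[\max_{x\in\mathcal X}\min_{\ell\le m}Y_{x,\ell}\Big]\ge\max_{x\in\mathcal X}\min_{\ell\le m}G(r_{x,\ell})-C\,\epsilon\,\sqrt{\log(m|\mathcal X|)}.$$ -/

import Mathlib

open MeasureTheory ProbabilityTheory Filter Topology

universe u v

noncomputable section

/-- The set `argmax_{a ∈ A} q a`. -/
def argmaxSet {𝒜 : Type*} (A : Set 𝒜) (q : 𝒜 → ℝ) : Set 𝒜 :=
  {a | a ∈ A ∧ ∀ b ∈ A, q b ≤ q a}

/-- The cluster of actions at state `x` that belongs to a cell `Θ` of environments: the admissible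
actions that are optimal in some environment `θ ∈ Θ`. Here `A x` is the set of admissible actions
and `Q θ x a` the optimal state-action value in environment `θ`. -/
def cluster {Env 𝒳 𝒜 : Type*} (A : 𝒳 → Set 𝒜) (Q : Env → 𝒳 → 𝒜 → ℝ) (Θ : Set Env) (x : 𝒳) :
    Set 𝒜 :=
  {a | ∃ θ ∈ Θ, a ∈ argmaxSet (A x) (Q θ x)}

/-- The cluster regret `Y = max_{a ∈ r} (Q(x,a) - Q(x,a₀))` of a cluster `r` at state `x` with
representative `a₀`, as a function of the environment `θ`. -/
def clusterRegret {Env 𝒳 𝒜 : Type*} (Q : Env → 𝒳 → 𝒜 → ℝ) (r : Set 𝒜) (x : 𝒳) (a₀ : 𝒜)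
    (θ : Env) : ℝ :=
  sSup ((fun a => Q θ x a - Q θ x a₀) '' r)

/-- The Gaussian width `G(S) = E max_{s ∈ S} ⟨u, s⟩`, `u ∼ γ`, where `γ` is the standard Gaussian
law on the space of environments and `pair u s = ⟨u, s⟩`. -/
def gaussianWidth {Env E : Type*} [MeasurableSpace Env] (γ : Measure Env) (pair : Env → E → ℝ)
    (S : Set E) : ℝ :=
  ∫ u, sSup (pair u '' S) ∂γ

/-- Square-summable real sequences with the `ℓ²` norm: the features for `n = ∞`. -/
abbrev SeqL2 : Type := lp (fun _ : ℕ => ℝ) 2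

/-- The law `N(0, I)` on `ℝ^ℕ`: independent standard normal coordinates. -/
def seqGaussian : Measure (ℕ → ℝ) := Measure.infinitePi (fun _ : ℕ => gaussianReal 0 1)

/-- Partial sums of the series `⟨θ, v⟩ = ∑ i, θ i * v i`. -/
def partialDot (θ : ℕ → ℝ) (v : SeqL2) (N : ℕ) : ℝ := ∑ i ∈ Finset.range N, θ i * v i

/-- The series `⟨θ, v⟩` converges. -/
def DotConverges (θ : ℕ → ℝ) (v : SeqL2) : Prop := ∃ q : ℝ, Tendsto (partialDot θ v) atTop (𝓝 q)

/-- The sum `⟨θ, v⟩ = ∑ i, θ i * v i`, meant for the `θ` for which the series converges. -/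
def seqDot (θ : ℕ → ℝ) (v : SeqL2) : ℝ := limUnder atTop (partialDot θ v)

end

/-!
Write `h_K(θ) = sup_{v ∈ K} ⟨θ, v⟩`. The regret of a cluster is `h_K` for the set `K` of its
features recentred at the representative, so `K` contains `0` and lies in the ball of radius `ε`, and
the mean of the regret is the Gaussian width of the cluster. Both inequalities therefore follow once the
deviations from the means, in either direction, of `N = m |𝒳|` such functions satisfy
`E max_p ± (h_{K_p} - E h_{K_p}) ≤ (π / 2) ε √(2 log N)`; `regret_bounds_of_deviation` is this step.

**Finite dimension.** For independent standard Gaussian vectors `x, y` it is enough, by Jensen's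
inequality, to bound `E max_p (h_{K_p}(x) - h_{K_p}(y))`. The point `x` is moved to `y` along the
rotation `cos t • x + sin t • y`. The law of the pair `(x, y)` is invariant under rotations, so the
expected maximal drop is subadditive in the angle (`integral_rotationGap_add_le`). For a small angle
`t`, let `a p` be a maximiser of `⟨x, ·⟩` on `K_p`; the drop of `h_{K_p}` is at most
`(1 - cos t) ⟨x, a p⟩ - sin t ⟨y, a p⟩`. Since `y` is independent of the maximisers, the second
term is a maximum of `N` Gaussian variables of standard deviation at most `ε`, and the first is of
second order in `t` (`integral_rotationGap_le`). Summing over equal steps from `0` to `π / 2` and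
letting their number grow gives the bound, without any differentiability or measurable selection.

**Infinite dimension.** The bounds pass to limits in mean, so it remains to show that the suprema
over `K` of the series truncated after `n` terms converge in mean to the supremum of the full series
(`integrable_and_tendsto_truncSup`). First, the supremum `M` over a countable dense subset is
integrable (`integrable_ciSup_seqDot`): finite maxima fall below their means, on average, by a
bounded amount only, so an almost surely finite supremum has bounded means of finite maxima. Next, the
truncated series are the conditional expectations of the full ones given the first coordinates, and
they are continuous on `K`, so the truncated suprema over all of `K` are at most the conditional
expectations of `M`. These converge to `M` almost surely and in mean by Lévy's upward theorem. This
shows at once that the supremum over the possibly uncountable `K` is almost surely equal to `M`, and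
hence measurable up to a null set, and that the truncated suprema converge to it in mean.
-/

/-! ### Finite maxima of integrable functions -/

section FiniteMaxima

variable {Ω ι : Type*} [MeasurableSpace Ω] {μ : Measure Ω} [Fintype ι]

lemma le_ciSup_finite (f : ι → ℝ) (i : ι) : f i ≤ ⨆ j, f j :=
  le_ciSup (Set.finite_range f).bddAbove i

lemma ciInf_finite_le (f : ι → ℝ) (i : ι) : ⨅ j, f j ≤ f i :=
  ciInf_le (Set.finite_range f).bddBelow i

variable [Nonempty ι]

lemma abs_ciSup_le_sum (f : ι → ℝ) : |⨆ i, f i| ≤ ∑ i, |f i| := by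
  obtain ⟨i, hi⟩ := exists_eq_ciSup_of_finite (f := f)
  rw [← hi]
  exact Finset.single_le_sum (f := fun i => |f i|) (fun _ _ => abs_nonneg _) (Finset.mem_univ i)

lemma abs_ciInf_le_sum (f : ι → ℝ) : |⨅ i, f i| ≤ ∑ i, |f i| := by
  obtain ⟨i, hi⟩ := exists_eq_ciInf_of_finite (f := f)
  rw [← hi]
  exact Finset.single_le_sum (f := fun i => |f i|) (fun _ _ => abs_nonneg _) (Finset.mem_univ i)

lemma integrable_ciSup {f : ι → Ω → ℝ} (hf : ∀ i, Integrable (f i) μ) :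
    Integrable (fun ω => ⨆ i, f i ω) μ :=
  (integrable_finsetSum Finset.univ fun i _ => (hf i).abs).mono'
    (AEMeasurable.iSup fun i => (hf i).aemeasurable).aestronglyMeasurable
    (ae_of_all _ fun ω => by simpa using abs_ciSup_le_sum fun i => f i ω)

lemma integrable_ciInf {f : ι → Ω → ℝ} (hf : ∀ i, Integrable (f i) μ) :
    Integrable (fun ω => ⨅ i, f i ω) μ :=
  (integrable_finsetSum Finset.univ fun i _ => (hf i).abs).mono'
    (AEMeasurable.iInf fun i => (hf i).aemeasurable).aestronglyMeasurable
    (ae_of_all _ fun ω => by simpa using abs_ciInf_le_sum fun i => f i ω)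

end FiniteMaxima

/-! ### Support functions of compact sets -/

section SupportFunction

variable {E : Type*} [NormedAddCommGroup E] [InnerProductSpace ℝ E]

/-- The support function `x ↦ sup_{s ∈ K} ⟨x, s⟩` of a set `K`. -/
noncomputable def supportFn (K : Set E) (x : E) : ℝ := sSup ((fun s => (inner ℝ x s : ℝ)) '' K)

lemma bddAbove_inner_image {K : Set E} (hK : IsCompact K) (x : E) :
    BddAbove ((fun s => (inner ℝ x s : ℝ)) '' K) :=
  (hK.image (by fun_prop)).bddAbove

lemma inner_le_supportFn {K : Set E} (hK : IsCompact K) (x : E) {s : E} (hs : s ∈ K) :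
    inner ℝ x s ≤ supportFn K x :=
  le_csSup (bddAbove_inner_image hK x) ⟨s, hs, rfl⟩

lemma exists_supportFn_eq {K : Set E} (hK : IsCompact K) (hne : K.Nonempty) (x : E) :
    ∃ s ∈ K, supportFn K x = inner ℝ x s :=
  hK.exists_sSup_image_eq hne (by fun_prop)

lemma abs_supportFn_sub_le {K : Set E} (hK : IsCompact K) (hne : K.Nonempty) {ε : ℝ}
    (hKε : ∀ s ∈ K, ‖s‖ ≤ ε) (x y : E) : |supportFn K x - supportFn K y| ≤ ε * ‖x - y‖ := by
  have main : ∀ x y : E, supportFn K x - supportFn K y ≤ ε * ‖x - y‖ := by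
    intro x y
    obtain ⟨s, hs, hxs⟩ := exists_supportFn_eq hK hne x
    calc supportFn K x - supportFn K y ≤ inner ℝ x s - inner ℝ y s := by
          rw [hxs]; linarith [inner_le_supportFn hK y hs]
      _ = inner ℝ (x - y) s := (inner_sub_left _ _ _).symm
      _ ≤ ‖x - y‖ * ‖s‖ := real_inner_le_norm _ _
      _ ≤ ε * ‖x - y‖ := by
          rw [mul_comm]
          gcongr
          exact hKε s hs
  rw [abs_sub_le_iff]
  exact ⟨main x y, norm_sub_rev x y ▸ main y x⟩

lemma continuous_supportFn {K : Set E} (hK : IsCompact K) (hne : K.Nonempty) :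
    Continuous (supportFn K) := by
  obtain ⟨ε, hε⟩ := hK.isBounded.exists_norm_le
  exact (LipschitzWith.of_dist_le' (K := ε) fun x y => by
    rw [Real.dist_eq, dist_eq_norm]
    exact abs_supportFn_sub_le hK hne hε x y).continuous

lemma abs_supportFn_le {K : Set E} (hK : IsCompact K) (hne : K.Nonempty) {ε : ℝ}
    (hKε : ∀ s ∈ K, ‖s‖ ≤ ε) (x : E) : |supportFn K x| ≤ ε * ‖x‖ := by
  have h := abs_supportFn_sub_le hK hne hKε x 0
  have h0 : supportFn K 0 = 0 := by
    obtain ⟨s, -, hs⟩ := exists_supportFn_eq hK hne 0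
    rw [hs, inner_zero_left]
  simpa [h0] using h

/-- The largest drop of the support functions of the sets `K p` when the first of two points
`z = (x, y)` is rotated by the angle `t` towards the second. -/
noncomputable def rotationGap {P : Type*} (K : P → Set E) (t : ℝ) (z : E × E) : ℝ :=
  ⨆ p, (supportFn (K p) z.1 - supportFn (K p) (Real.cos t • z.1 + Real.sin t • z.2))

lemma rotationGap_pi_div_two {P : Type*} (K : P → Set E) (x y : E) :
    rotationGap K (Real.pi / 2) (x, y) = ⨆ p, (supportFn (K p) x - supportFn (K p) y) := by
  simp [rotationGap]

end SupportFunction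

/-! ### Maxima of finitely many Gaussian variables -/

/-- Optimising `L / t + t ε² / 2` over `t > 0`, degenerate cases included. -/
lemma le_mul_sqrt_of_forall_le_div_add {a L ε : ℝ} (hL : 0 ≤ L) (hε : 0 ≤ ε)
    (h : ∀ t : ℝ, 0 < t → t * a ≤ L + t ^ 2 * ε ^ 2 / 2) : a ≤ ε * √(2 * L) := by
  -- the optimal `t` is `√(2L) / ε`; `δ` keeps it away from the degenerate values
  refine le_of_forall_pos_le_add fun η hη => ?_
  have hs := Real.sq_sqrt (show 0 ≤ 2 * L by positivity)
  set s := √(2 * L) with hs_def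
  have hs0 : 0 ≤ s := Real.sqrt_nonneg _
  have key : ∀ δ : ℝ, 0 < δ → a ≤ (s + δ) * (ε + δ) := by
    intro δ hδ
    have h1 := h ((s + δ) / (ε + δ)) (by positivity)
    have hpos : 0 < ε + δ := by positivity
    have hpos' : 0 < s + δ := by positivity
    have h2 : ((s + δ) / (ε + δ)) ^ 2 * ε ^ 2 ≤ (s + δ) ^ 2 := by
      rw [div_pow, div_mul_eq_mul_div, div_le_iff₀ (by positivity)]
      gcongr
      linarith
    have h3 : L ≤ (s + δ) ^ 2 / 2 := by nlinarith
    have h4 : (s + δ) / (ε + δ) * a ≤ (s + δ) ^ 2 := by linarith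
    rw [div_mul_eq_mul_div, div_le_iff₀ hpos] at h4
    have : (s + δ) * a ≤ (s + δ) * ((s + δ) * (ε + δ)) := by nlinarith
    exact le_of_mul_le_mul_left this hpos'
  have hlim : Tendsto (fun δ : ℝ => (s + δ) * (ε + δ)) (𝓝[>] 0) (𝓝 ((s + 0) * (ε + 0))) :=
    ((Continuous.tendsto (by fun_prop) 0).mono_left nhdsWithin_le_nhds)
  have : a ≤ (s + 0) * (ε + 0) :=
    ge_of_tendsto hlim (eventually_nhdsWithin_of_forall fun δ hδ => key δ hδ)
  nlinarith

section StdGaussian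

variable {E : Type*} [NormedAddCommGroup E] [InnerProductSpace ℝ E] [FiniteDimensional ℝ E]
  [MeasurableSpace E] [BorelSpace E]

lemma map_inner_stdGaussian (w : E) :
    (stdGaussian E).map (fun y => inner ℝ y w) = gaussianReal 0 (‖w‖ ^ 2).toNNReal := by
  have h := IsGaussian.map_eq_gaussianReal (μ := stdGaussian E) (innerSL ℝ w)
  rw [variance_dual_stdGaussian, integral_strongDual_stdGaussian, innerSL_apply_norm] at h
  rw [← h]
  congr 1
  ext
  exact real_inner_comm _ _

lemma integrable_inner_stdGaussian (w : E) :
    Integrable (fun y => inner ℝ y w) (stdGaussian E) :=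
  (IsGaussian.integrable_dual (stdGaussian E) (innerSL ℝ w)).congr
    (ae_of_all _ fun _ => real_inner_comm _ _)

lemma integral_inner_stdGaussian (w : E) : ∫ y, inner ℝ y w ∂(stdGaussian E) = 0 := by
  rw [← integral_strongDual_stdGaussian (innerSL ℝ w)]
  exact integral_congr_ae (ae_of_all _ fun _ => real_inner_comm _ _)

lemma integrable_norm_stdGaussian : Integrable (fun x : E => ‖x‖) (stdGaussian E) :=
  (IsGaussian.integrable_id (μ := stdGaussian E)).norm

/-- The maximum of `N` centred Gaussian variables of standard deviation at most `ε` has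
expectation at most `ε √(2 log N)`. -/
lemma integral_ciSup_inner_stdGaussian_le {P : Type*} [Fintype P] [Nonempty P] {ε : ℝ}
    (hε : 0 ≤ ε) (w : P → E) (hw : ∀ p, ‖w p‖ ≤ ε) :
    ∫ y, (⨆ p, inner ℝ y (w p)) ∂(stdGaussian E) ≤ ε * √(2 * Real.log (Fintype.card P)) := by
  have hN : (1 : ℝ) ≤ Fintype.card P := by exact_mod_cast Fintype.card_pos
  refine le_mul_sqrt_of_forall_le_div_add (Real.log_nonneg hN) hε fun t ht => ?_
  have hint : Integrable (fun y => ⨆ p, inner ℝ y (w p)) (stdGaussian E) :=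
    integrable_ciSup fun p => integrable_inner_stdGaussian (w p)
  have hexp : ∀ p, Integrable (fun y => Real.exp (t * inner ℝ y (w p))) (stdGaussian E) := by
    intro p
    have := integrable_exp_mul_gaussianReal (μ := 0) (v := (‖w p‖ ^ 2).toNNReal) t
    rw [← map_inner_stdGaussian] at this
    exact this.comp_measurable (by fun_prop)
  have hle : ∀ y, Real.exp (t * ⨆ p, inner ℝ y (w p)) ≤
      ∑ p, Real.exp (t * inner ℝ y (w p)) := by
    intro y
    obtain ⟨p, hp⟩ := exists_eq_ciSup_of_finite (f := fun p => inner ℝ y (w p))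
    rw [← hp]
    exact Finset.single_le_sum (f := fun p => Real.exp (t * inner ℝ y (w p)))
      (fun _ _ => (Real.exp_pos _).le) (Finset.mem_univ p)
  have hsum : Integrable (fun y => ∑ p, Real.exp (t * inner ℝ y (w p))) (stdGaussian E) :=
    integrable_finsetSum _ fun p _ => hexp p
  have hexpsup : Integrable (fun y => Real.exp (t * ⨆ p, inner ℝ y (w p))) (stdGaussian E) :=
    hsum.mono' (Real.measurable_exp.comp_aemeasurable
      (hint.aemeasurable.const_mul t)).aestronglyMeasurable
      (ae_of_all _ fun y => by simpa using hle y)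
  have hmgf : ∀ p, ∫ y, Real.exp (t * inner ℝ y (w p)) ∂(stdGaussian E) ≤
      Real.exp (t ^ 2 * ε ^ 2 / 2) := by
    intro p
    have := mgf_gaussianReal (map_inner_stdGaussian (w p)) t
    rw [mgf] at this
    rw [this, Real.coe_toNNReal _ (by positivity)]
    apply Real.exp_le_exp.2
    have : ‖w p‖ ^ 2 ≤ ε ^ 2 := by gcongr; exact hw p
    nlinarith [sq_nonneg t]
  have hjensen : Real.exp (∫ y, t * (⨆ p, inner ℝ y (w p)) ∂(stdGaussian E)) ≤
      ∫ y, Real.exp (t * ⨆ p, inner ℝ y (w p)) ∂(stdGaussian E) :=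
    convexOn_exp.map_integral_le (by fun_prop) isClosed_univ (ae_of_all _ fun _ => Set.mem_univ _)
      (hint.const_mul t) hexpsup
  have hchain : Real.exp (t * ∫ y, (⨆ p, inner ℝ y (w p)) ∂(stdGaussian E)) ≤
      Fintype.card P * Real.exp (t ^ 2 * ε ^ 2 / 2) := by
    rw [← integral_const_mul]
    refine hjensen.trans ((integral_mono hexpsup hsum hle).trans ?_)
    rw [integral_finsetSum _ fun p _ => hexp p]
    refine (Finset.sum_le_sum fun p _ => hmgf p).trans ?_
    simp
  rw [← Real.exp_log (show (0 : ℝ) < Fintype.card P by linarith), ← Real.exp_add] at hchain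
  exact Real.exp_le_exp.1 hchain

/-! ### Gaussian rotations -/

lemma integrable_supportFn {K : Set E} (hK : IsCompact K) (hne : K.Nonempty) :
    Integrable (supportFn K) (stdGaussian E) := by
  obtain ⟨ε, hε⟩ := hK.isBounded.exists_norm_le
  exact (integrable_norm_stdGaussian.const_mul ε).mono'
    (continuous_supportFn hK hne).aestronglyMeasurable
    (ae_of_all _ fun x => abs_supportFn_le hK hne hε x)

variable {P : Type*} {K : P → Set E}

lemma measurePreserving_rotation (t : ℝ) :
    MeasurePreserving (ContinuousLinearMap.rotation t : E × E →L[ℝ] E × E)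
      ((stdGaussian E).prod (stdGaussian E)) ((stdGaussian E).prod (stdGaussian E)) :=
  ⟨by fun_prop, IsGaussian.map_rotation_eq_self (by simp) t⟩

lemma integrable_supportFn_sub_rotated (hK : ∀ p, IsCompact (K p)) (hne : ∀ p, (K p).Nonempty)
    (t : ℝ) (p : P) :
    Integrable (fun z : E × E =>
      supportFn (K p) z.1 - supportFn (K p) (Real.cos t • z.1 + Real.sin t • z.2))
      ((stdGaussian E).prod (stdGaussian E)) := by
  have h1 : Integrable (fun z : E × E => supportFn (K p) z.1)
      ((stdGaussian E).prod (stdGaussian E)) := (integrable_supportFn (hK p) (hne p)).comp_fst _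
  exact h1.sub ((measurePreserving_rotation t).integrable_comp_of_integrable h1)

variable [Fintype P] [Nonempty P]

lemma integrable_rotationGap (hK : ∀ p, IsCompact (K p)) (hne : ∀ p, (K p).Nonempty) (t : ℝ) :
    Integrable (rotationGap K t) ((stdGaussian E).prod (stdGaussian E)) :=
  integrable_ciSup fun p => integrable_supportFn_sub_rotated hK hne t p

/-- Subadditivity in the angle: a rotation by `s + t` is a rotation by `s` followed by one by `t`,
and the pair seen by the second rotation has the law of the first pair. -/
lemma integral_rotationGap_add_le (hK : ∀ p, IsCompact (K p)) (hne : ∀ p, (K p).Nonempty)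
    (s t : ℝ) :
    ∫ z, rotationGap K (s + t) z ∂((stdGaussian E).prod (stdGaussian E)) ≤
      ∫ z, rotationGap K s z ∂((stdGaussian E).prod (stdGaussian E)) +
        ∫ z, rotationGap K t z ∂((stdGaussian E).prod (stdGaussian E)) := by
  have hmp := measurePreserving_rotation (E := E) s
  have hint := integrable_rotationGap hK hne t
  have heq : ∫ z, rotationGap K t z ∂((stdGaussian E).prod (stdGaussian E)) =
      ∫ z, rotationGap K t (ContinuousLinearMap.rotation s z)
        ∂((stdGaussian E).prod (stdGaussian E)) := by
    conv_lhs => rw [← hmp.map_eq]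
    exact integral_map hmp.measurable.aemeasurable (by rw [hmp.map_eq]; exact hint.1)
  have hrot : Integrable (fun z => rotationGap K t (ContinuousLinearMap.rotation s z))
      ((stdGaussian E).prod (stdGaussian E)) := hmp.integrable_comp_of_integrable hint
  rw [heq, ← integral_add (integrable_rotationGap hK hne s) hrot]
  refine integral_mono (integrable_rotationGap hK hne _)
    ((integrable_rotationGap hK hne s).add hrot) fun z => ?_
  refine ciSup_le fun p => ?_
  have h1 : supportFn (K p) z.1 - supportFn (K p) (Real.cos s • z.1 + Real.sin s • z.2) ≤
      rotationGap K s z := le_ciSup_finite (fun p => supportFn (K p) z.1 -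
    supportFn (K p) (Real.cos s • z.1 + Real.sin s • z.2)) p
  have h2 : supportFn (K p) (ContinuousLinearMap.rotation s z).1 -
      supportFn (K p) (Real.cos t • (ContinuousLinearMap.rotation s z).1 +
        Real.sin t • (ContinuousLinearMap.rotation s z).2) ≤
      rotationGap K t (ContinuousLinearMap.rotation s z) :=
    le_ciSup_finite (fun p => supportFn (K p) (ContinuousLinearMap.rotation s z).1 -
      supportFn (K p) (Real.cos t • (ContinuousLinearMap.rotation s z).1 +
        Real.sin t • (ContinuousLinearMap.rotation s z).2)) p
  have h3 : Real.cos t • (ContinuousLinearMap.rotation s z).1 +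
      Real.sin t • (ContinuousLinearMap.rotation s z).2 =
      Real.cos (s + t) • z.1 + Real.sin (s + t) • z.2 := by
    simp only [ContinuousLinearMap.rotation_apply, Real.cos_add, Real.sin_add]
    module
  rw [h3, show (ContinuousLinearMap.rotation s z).1 = Real.cos s • z.1 + Real.sin s • z.2 from rfl]
    at h2
  refine le_trans ?_ (add_le_add h1 h2)
  linarith

lemma integral_rotationGap_nat_mul_le (hK : ∀ p, IsCompact (K p)) (hne : ∀ p, (K p).Nonempty)
    (t : ℝ) (n : ℕ) :
    ∫ z, rotationGap K (n * t) z ∂((stdGaussian E).prod (stdGaussian E)) ≤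
      n * ∫ z, rotationGap K t z ∂((stdGaussian E).prod (stdGaussian E)) := by
  induction n with
  | zero => simp [rotationGap]
  | succ n ih =>
    have := integral_rotationGap_add_le hK hne (n * t) t
    rw [show (n : ℝ) * t + t = ((n + 1 : ℕ) : ℝ) * t by push_cast; ring] at this
    push_cast at this ⊢
    linarith

/-- For a small angle the drop is governed by the maximisers `a p` at the first point `x`: it is
at most `(1 - cos t) ⟨x, a p⟩ - sin t ⟨y, a p⟩`, and `y` is independent of `a p`. -/
lemma integral_rotationGap_le (hK : ∀ p, IsCompact (K p)) (hne : ∀ p, (K p).Nonempty) {ε : ℝ}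
    (hε : 0 ≤ ε) (hKε : ∀ p, ∀ s ∈ K p, ‖s‖ ≤ ε) {t : ℝ} (ht : 0 ≤ Real.sin t) :
    ∫ z, rotationGap K t z ∂((stdGaussian E).prod (stdGaussian E)) ≤
      (1 - Real.cos t) * (ε * ∫ x : E, ‖x‖ ∂(stdGaussian E)) +
        Real.sin t * (ε * √(2 * Real.log (Fintype.card P))) := by
  have hint := integrable_rotationGap hK hne t
  rw [integral_prod _ hint]
  have hmain : ∀ᵐ x ∂(stdGaussian E), ∫ y, rotationGap K t (x, y) ∂(stdGaussian E) ≤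
      (1 - Real.cos t) * (ε * ‖x‖) + Real.sin t * (ε * √(2 * Real.log (Fintype.card P))) := by
    filter_upwards [hint.prod_right_ae] with x hx
    choose a ha hxa using fun p => exists_supportFn_eq (hK p) (hne p) x
    have hw : Integrable (fun y => ⨆ p, inner ℝ y (-a p)) (stdGaussian E) :=
      integrable_ciSup fun p => integrable_inner_stdGaussian _
    have hle : ∀ y, rotationGap K t (x, y) ≤
        (1 - Real.cos t) * (ε * ‖x‖) + Real.sin t * ⨆ p, inner ℝ y (-a p) := by
      refine fun y => ciSup_le fun p => ?_
      have h1 := inner_le_supportFn (hK p) (Real.cos t • x + Real.sin t • y) (ha p)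
      have h2 := le_ciSup_finite (fun p => (inner ℝ y (-a p) : ℝ)) p
      have h3 : (inner ℝ x (a p) : ℝ) ≤ ε * ‖x‖ := by
        refine (real_inner_le_norm _ _).trans ?_
        rw [mul_comm]
        gcongr
        exact hKε p _ (ha p)
      rw [inner_add_left, real_inner_smul_left, real_inner_smul_left] at h1
      simp only [inner_neg_right] at h2 ⊢
      rw [hxa p]
      have h4 := mul_le_mul_of_nonneg_left h3 (sub_nonneg.2 (Real.cos_le_one t))
      have h5 := mul_le_mul_of_nonneg_left h2 ht
      linarith
    refine (integral_mono hx ((integrable_const _).add (hw.const_mul _)) hle).trans ?_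
    rw [integral_add' (integrable_const _) (hw.const_mul _),
      integral_const_mul (Real.sin t)]
    simp only [integral_const, probReal_univ, one_smul]
    gcongr
    exact integral_ciSup_inner_stdGaussian_le hε _ fun p => by simpa using hKε p _ (ha p)
  have hn : Integrable (fun x : E => (1 - Real.cos t) * (ε * ‖x‖)) (stdGaussian E) :=
    (integrable_norm_stdGaussian.const_mul ε).const_mul _
  refine (integral_mono_ae hint.integral_prod_left (hn.add (integrable_const _)) hmain).trans ?_
  rw [integral_add' hn (integrable_const _), integral_const_mul, integral_const_mul]
  simp

/-- Letting the number of equal rotation steps from `0` to `π / 2` tend to infinity. -/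
lemma integral_rotationGap_pi_div_two_le (hK : ∀ p, IsCompact (K p)) (hne : ∀ p, (K p).Nonempty)
    {ε : ℝ} (hε : 0 ≤ ε) (hKε : ∀ p, ∀ s ∈ K p, ‖s‖ ≤ ε) :
    ∫ z, rotationGap K (Real.pi / 2) z ∂((stdGaussian E).prod (stdGaussian E)) ≤
      Real.pi / 2 * (ε * √(2 * Real.log (Fintype.card P))) := by
  set A := ε * ∫ x : E, ‖x‖ ∂(stdGaussian E) with hA
  set B := ε * √(2 * Real.log (Fintype.card P)) with hB
  have hA0 : 0 ≤ A := mul_nonneg hε (integral_nonneg fun _ => norm_nonneg _)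
  have hB0 : 0 ≤ B := by positivity
  have key : ∀ n : ℕ, ∫ z, rotationGap K (Real.pi / 2) z ∂((stdGaussian E).prod (stdGaussian E)) ≤
      (Real.pi / 2) ^ 2 / 2 * A * (1 / ((n : ℝ) + 1)) + Real.pi / 2 * B := by
    intro n
    have hn : (0 : ℝ) < (n : ℝ) + 1 := by positivity
    set t := Real.pi / 2 / ((n : ℝ) + 1) with ht
    have ht0 : 0 ≤ t := by positivity
    have htpi : t ≤ Real.pi := by
      rw [ht, div_le_iff₀ hn]
      nlinarith [Real.pi_pos, (Nat.cast_nonneg n : (0 : ℝ) ≤ n)]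
    have h1 := integral_rotationGap_nat_mul_le hK hne t (n + 1)
    have h2 : ((n + 1 : ℕ) : ℝ) * t = Real.pi / 2 := by
      rw [ht]; push_cast; field_simp
    rw [h2] at h1
    have h3 := integral_rotationGap_le hK hne hε hKε (Real.sin_nonneg_of_nonneg_of_le_pi ht0 htpi)
    have h4 : 1 - Real.cos t ≤ t ^ 2 / 2 := by linarith [Real.one_sub_sq_div_two_le_cos (x := t)]
    have h5 : Real.sin t ≤ t := Real.sin_le ht0
    have h6 : ∫ z, rotationGap K t z ∂((stdGaussian E).prod (stdGaussian E)) ≤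
        t ^ 2 / 2 * A + t * B := h3.trans (by gcongr)
    refine h1.trans ((mul_le_mul_of_nonneg_left h6 (by positivity)).trans_eq ?_)
    rw [ht]; push_cast; field_simp
  have hlim : Tendsto (fun n : ℕ => (Real.pi / 2) ^ 2 / 2 * A * (1 / ((n : ℝ) + 1)) +
      Real.pi / 2 * B) atTop (𝓝 ((Real.pi / 2) ^ 2 / 2 * A * 0 + Real.pi / 2 * B)) :=
    (tendsto_one_div_add_atTop_nhds_zero_nat.const_mul _).add_const _
  simpa using ge_of_tendsto' hlim key

/-- Upper deviations of finitely many support functions from their Gaussian means. -/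
lemma integral_ciSup_supportFn_sub_integral_le (hK : ∀ p, IsCompact (K p))
    (hne : ∀ p, (K p).Nonempty) {ε : ℝ} (hε : 0 ≤ ε) (hKε : ∀ p, ∀ s ∈ K p, ‖s‖ ≤ ε) :
    ∫ x, (⨆ p, (supportFn (K p) x - ∫ y, supportFn (K p) y ∂(stdGaussian E))) ∂(stdGaussian E) ≤
      Real.pi / 2 * (ε * √(2 * Real.log (Fintype.card P))) := by
  refine le_trans ?_ (integral_rotationGap_pi_div_two_le hK hne hε hKε)
  have hint := integrable_rotationGap hK hne (Real.pi / 2)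
  have hs := fun p => integrable_supportFn (hK p) (hne p)
  rw [integral_prod _ hint]
  refine integral_mono_ae (integrable_ciSup fun p => (hs p).sub (integrable_const _))
    hint.integral_prod_left ?_
  filter_upwards [hint.prod_right_ae] with x hx
  refine ciSup_le fun p => ?_
  have : supportFn (K p) x - ∫ y, supportFn (K p) y ∂(stdGaussian E) =
      ∫ y, (supportFn (K p) x - supportFn (K p) y) ∂(stdGaussian E) := by
    rw [integral_sub (integrable_const _) (hs p)]; simp
  rw [this]
  refine integral_mono ((integrable_const _).sub (hs p)) hx fun y => ?_
  simp only [rotationGap_pi_div_two]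
  exact le_ciSup_finite (fun p => supportFn (K p) x - supportFn (K p) y) p

/-- Lower deviations of finitely many support functions from their Gaussian means. -/
lemma integral_ciSup_integral_sub_supportFn_le (hK : ∀ p, IsCompact (K p))
    (hne : ∀ p, (K p).Nonempty) {ε : ℝ} (hε : 0 ≤ ε) (hKε : ∀ p, ∀ s ∈ K p, ‖s‖ ≤ ε) :
    ∫ x, (⨆ p, (∫ y, supportFn (K p) y ∂(stdGaussian E) - supportFn (K p) x)) ∂(stdGaussian E) ≤
      Real.pi / 2 * (ε * √(2 * Real.log (Fintype.card P))) := by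
  refine le_trans ?_ (integral_rotationGap_pi_div_two_le hK hne hε hKε)
  have hint := integrable_rotationGap hK hne (Real.pi / 2)
  have hs := fun p => integrable_supportFn (hK p) (hne p)
  rw [integral_prod_symm _ hint]
  refine integral_mono_ae (integrable_ciSup fun p => (integrable_const _).sub (hs p))
    hint.integral_prod_right ?_
  filter_upwards [hint.prod_left_ae] with x hx
  refine ciSup_le fun p => ?_
  have : ∫ y, supportFn (K p) y ∂(stdGaussian E) - supportFn (K p) x =
      ∫ y, (supportFn (K p) y - supportFn (K p) x) ∂(stdGaussian E) := by
    rw [integral_sub (hs p) (integrable_const _)]; simp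
  rw [this]
  refine integral_mono ((hs p).sub (integrable_const _)) hx fun y => ?_
  simp only [rotationGap_pi_div_two]
  exact le_ciSup_finite (fun p => supportFn (K p) y - supportFn (K p) x) p

end StdGaussian

/-! ### From deviation bounds to maxima and max-min values -/

section Assembly

variable {Ω : Type*} [MeasurableSpace Ω] {μ : Measure Ω} [IsProbabilityMeasure μ]

lemma integral_ciSup_le_of_deviation {P : Type*} [Fintype P] [Nonempty P] {Y : P → Ω → ℝ}
    (hY : ∀ p, Integrable (Y p) μ) {B : ℝ}
    (hB : ∫ ω, (⨆ p, (Y p ω - ∫ ω', Y p ω' ∂μ)) ∂μ ≤ B) :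
    ∫ ω, (⨆ p, Y p ω) ∂μ ≤ (⨆ p, ∫ ω, Y p ω ∂μ) + B := by
  have hdev : Integrable (fun ω => ⨆ p, (Y p ω - ∫ ω', Y p ω' ∂μ)) μ :=
    integrable_ciSup fun p => (hY p).sub (integrable_const _)
  have hle : ∀ ω, (⨆ p, Y p ω) ≤
      (⨆ p, ∫ ω', Y p ω' ∂μ) + ⨆ p, (Y p ω - ∫ ω', Y p ω' ∂μ) := fun ω => ciSup_le fun p => by
    linarith [le_ciSup_finite (fun p => ∫ ω', Y p ω' ∂μ) p,
      le_ciSup_finite (fun p => Y p ω - ∫ ω', Y p ω' ∂μ) p]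
  refine (integral_mono (integrable_ciSup hY) ((integrable_const _).add hdev) hle).trans ?_
  rw [integral_add' (integrable_const _) hdev]
  simpa using hB

lemma le_integral_ciSup_ciInf_of_deviation {X ι : Type*} [Fintype X] [Nonempty X] [Fintype ι]
    [Nonempty ι] {Y : X → ι → Ω → ℝ} (hY : ∀ x l, Integrable (Y x l) μ) {B : ℝ}
    (hB : ∫ ω, (⨆ p : X × ι, (∫ ω', Y p.1 p.2 ω' ∂μ - Y p.1 p.2 ω)) ∂μ ≤ B) :
    (⨆ x, ⨅ l, ∫ ω, Y x l ω ∂μ) - B ≤ ∫ ω, (⨆ x, ⨅ l, Y x l ω) ∂μ := by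
  have hdev : Integrable (fun ω => ⨆ p : X × ι, (∫ ω', Y p.1 p.2 ω' ∂μ - Y p.1 p.2 ω)) μ :=
    integrable_ciSup fun p => (integrable_const _).sub (hY p.1 p.2)
  have hmm : Integrable (fun ω => ⨆ x, ⨅ l, Y x l ω) μ :=
    integrable_ciSup fun x => integrable_ciInf (hY x)
  have hle : ∀ ω, (⨆ x, ⨅ l, ∫ ω', Y x l ω' ∂μ) ≤
      (⨆ x, ⨅ l, Y x l ω) + ⨆ p : X × ι, (∫ ω', Y p.1 p.2 ω' ∂μ - Y p.1 p.2 ω) := by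
    intro ω
    refine ciSup_le fun x => ?_
    have h1 := le_ciSup_finite (fun x => ⨅ l, Y x l ω) x
    obtain ⟨l, hl⟩ := exists_eq_ciInf_of_finite (f := fun l => Y x l ω)
    linarith [ciInf_finite_le (fun l => ∫ ω', Y x l ω' ∂μ) l,
      le_ciSup_finite (fun p : X × ι => ∫ ω', Y p.1 p.2 ω' ∂μ - Y p.1 p.2 ω) (x, l)]
  have h := integral_mono (integrable_const _) (hmm.add hdev) hle
  rw [integral_add' hmm hdev] at h
  simp only [integral_const, probReal_univ, one_smul] at h
  linarith

end Assembly

/-! ### Convergence in mean of finite maxima -/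

section MeanConvergence

variable {Ω ι : Type*} [MeasurableSpace Ω] {μ : Measure Ω} [Fintype ι] [Nonempty ι]

lemma abs_ciSup_sub_ciSup_le_sum (f g : ι → ℝ) :
    |(⨆ i, f i) - ⨆ i, g i| ≤ ∑ i, |f i - g i| := by
  have main : ∀ f g : ι → ℝ, (⨆ i, f i) - ⨆ i, g i ≤ ∑ i, |f i - g i| := by
    intro f g
    rw [sub_le_iff_le_add']
    refine ciSup_le fun i => ?_
    have h1 := Finset.single_le_sum (f := fun i => |f i - g i|) (fun _ _ => abs_nonneg _)
      (Finset.mem_univ i)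
    linarith [le_ciSup_finite g i, le_abs_self (f i - g i)]
  rw [abs_sub_le_iff]
  refine ⟨main f g, ?_⟩
  simpa only [abs_sub_comm] using main g f

lemma tendsto_eLpNorm_ciSup_sub {f : ι → ℕ → Ω → ℝ} {g : ι → Ω → ℝ}
    (hf : ∀ i n, Integrable (f i n) μ) (hg : ∀ i, Integrable (g i) μ)
    (h : ∀ i, Tendsto (fun n => eLpNorm (f i n - g i) 1 μ) atTop (𝓝 0)) :
    Tendsto (fun n => eLpNorm ((fun ω => ⨆ i, f i n ω) - fun ω => ⨆ i, g i ω) 1 μ)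
      atTop (𝓝 0) := by
  have hsum : Tendsto (fun n => ∑ i, eLpNorm (f i n - g i) 1 μ) atTop (𝓝 0) := by
    simpa using tendsto_finsetSum Finset.univ fun i _ => h i
  refine tendsto_of_tendsto_of_tendsto_of_le_of_le tendsto_const_nhds hsum
    (fun _ => zero_le) fun n => ?_
  calc eLpNorm ((fun ω => ⨆ i, f i n ω) - fun ω => ⨆ i, g i ω) 1 μ
      ≤ eLpNorm (∑ i, fun ω => ‖f i n ω - g i ω‖) 1 μ := by
        refine eLpNorm_mono_real fun ω => ?_
        rw [Finset.sum_apply]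
        exact abs_ciSup_sub_ciSup_le_sum (fun i => f i n ω) fun i => g i ω
    _ ≤ ∑ i, eLpNorm (fun ω => ‖f i n ω - g i ω‖) 1 μ :=
        eLpNorm_sum_le (fun i _ => ((hf i n).sub (hg i)).norm.1) le_rfl
    _ = ∑ i, eLpNorm (f i n - g i) 1 μ :=
        Finset.sum_congr rfl fun i _ => eLpNorm_norm (f i n - g i)

/-- The expected maximal deviation from the means passes to limits in mean. -/
lemma integral_ciSup_deviation_le_of_tendsto [IsProbabilityMeasure μ] {f : ι → ℕ → Ω → ℝ}
    {g : ι → Ω → ℝ} (hf : ∀ i n, Integrable (f i n) μ) (hg : ∀ i, Integrable (g i) μ)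
    (h : ∀ i, Tendsto (fun n => eLpNorm (f i n - g i) 1 μ) atTop (𝓝 0)) {B : ℝ}
    (hB : ∀ n, ∫ ω, (⨆ i, (f i n ω - ∫ ω', f i n ω' ∂μ)) ∂μ ≤ B) :
    ∫ ω, (⨆ i, (g i ω - ∫ ω', g i ω' ∂μ)) ∂μ ≤ B := by
  have hF : ∀ i n, Integrable (fun ω => f i n ω - ∫ ω', f i n ω' ∂μ) μ :=
    fun i n => (hf i n).sub (integrable_const _)
  have hG : ∀ i, Integrable (fun ω => g i ω - ∫ ω', g i ω' ∂μ) μ :=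
    fun i => (hg i).sub (integrable_const _)
  refine le_of_tendsto' (tendsto_integral_of_L1' _ (integrable_ciSup hG).1
    (Eventually.of_forall fun n => integrable_ciSup fun i => hF i n)
    (tendsto_eLpNorm_ciSup_sub hF hG fun i => ?_)) hB
  have hmean : Tendsto (fun n => ∫ ω, f i n ω ∂μ) atTop (𝓝 (∫ ω, g i ω ∂μ)) :=
    tendsto_integral_of_L1' _ (hg i).1 (Eventually.of_forall fun n => hf i n) (h i)
  have hconst : Tendsto (fun n => ‖(∫ ω, f i n ω ∂μ) - ∫ ω, g i ω ∂μ‖ₑ) atTop (𝓝 0) := by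
    simpa using (hmean.sub_const (∫ ω, g i ω ∂μ)).enorm
  have hsum := (h i).add hconst
  rw [add_zero] at hsum
  refine tendsto_of_tendsto_of_tendsto_of_le_of_le tendsto_const_nhds hsum
    (fun _ => zero_le) fun n => ?_
  have hsplit : ((fun ω => f i n ω - ∫ ω', f i n ω' ∂μ) - fun ω => g i ω - ∫ ω', g i ω' ∂μ) =
      (f i n - g i) - fun _ => (∫ ω, f i n ω ∂μ) - ∫ ω, g i ω ∂μ := by
    ext ω; simp only [Pi.sub_apply]; ring
  rw [hsplit]
  refine (eLpNorm_sub_le ((hf i n).sub (hg i)).1 aestronglyMeasurable_const le_rfl).trans ?_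
  gcongr
  rw [eLpNorm_const' _ one_ne_zero ENNReal.one_ne_top]
  simp

end MeanConvergence

/-! ### Truncations of the Gaussian series -/

section Series

instance : IsProbabilityMeasure seqGaussian := by
  unfold seqGaussian
  infer_instance

/-- The first `N` terms of a sequence, as a Euclidean vector. -/
noncomputable def headVec (N : ℕ) (f : ℕ → ℝ) : EuclideanSpace ℝ (Finset.range N) :=
  WithLp.toLp 2 ((Finset.range N).restrict f)

lemma headVec_sub (N : ℕ) (f g : ℕ → ℝ) : headVec N (f - g) = headVec N f - headVec N g := rfl

lemma measurable_headVec (N : ℕ) : Measurable (headVec N) :=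
  (WithLp.measurable_toLp 2 _).comp (Finset.measurable_restrict _)

lemma map_headVec_seqGaussian (N : ℕ) :
    seqGaussian.map (headVec N) = stdGaussian (EuclideanSpace ℝ (Finset.range N)) := by
  rw [← map_pi_eq_stdGaussian, ← Measure.infinitePi_map_restrict (fun _ : ℕ => gaussianReal 0 1)]
  exact (Measure.map_map (μ := Measure.infinitePi fun _ : ℕ => gaussianReal 0 1)
    (WithLp.measurable_toLp 2 _) (Finset.measurable_restrict _)).symm

lemma measurePreserving_headVec (N : ℕ) : MeasurePreserving (headVec N) seqGaussian
    (stdGaussian (EuclideanSpace ℝ (Finset.range N))) :=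
  ⟨measurable_headVec N, map_headVec_seqGaussian N⟩

lemma integral_comp_headVec {N : ℕ} {f : EuclideanSpace ℝ (Finset.range N) → ℝ}
    (hf : Integrable f (stdGaussian (EuclideanSpace ℝ (Finset.range N)))) :
    ∫ θ, f (headVec N θ) ∂seqGaussian =
      ∫ y, f y ∂(stdGaussian (EuclideanSpace ℝ (Finset.range N))) := by
  rw [← map_headVec_seqGaussian, integral_map (measurable_headVec N).aemeasurable]
  rw [map_headVec_seqGaussian]
  exact hf.1

lemma inner_headVec (N : ℕ) (θ : ℕ → ℝ) (v : SeqL2) :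
    inner ℝ (headVec N θ) (headVec N v) = partialDot θ v N := by
  have h := Finset.sum_coe_sort (Finset.range N) fun i => θ i * v i
  simpa [headVec, PiLp.inner_apply, partialDot, mul_comm] using h

lemma norm_headVec_le (N : ℕ) (v : SeqL2) : ‖headVec N v‖ ≤ ‖v‖ := by
  refine le_of_sq_le_sq ?_ (norm_nonneg _)
  have h := lp.sum_rpow_le_norm_rpow (p := 2) (by norm_num) v (Finset.range N)
  rw [EuclideanSpace.norm_sq_eq]
  simp only [headVec, Finset.restrict]
  rw [Finset.sum_coe_sort (Finset.range N) (fun i => ‖v i‖ ^ 2)]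
  simpa using h

lemma continuous_headVec (N : ℕ) : Continuous fun v : SeqL2 => headVec N v :=
  (LipschitzWith.of_dist_le' (K := 1) fun v w => by
    rw [dist_eq_norm, dist_eq_norm, ← headVec_sub, one_mul]
    exact norm_headVec_le N (v - w)).continuous

lemma measurable_partialDot (v : SeqL2) (N : ℕ) : Measurable fun θ => partialDot θ v N :=
  Finset.measurable_sum _ fun i _ => (measurable_pi_apply i).mul_const _

lemma integrable_partialDot (v : SeqL2) (N : ℕ) :
    Integrable (fun θ => partialDot θ v N) seqGaussian := by
  have h := (measurePreserving_headVec N).integrable_comp_of_integrable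
    (integrable_inner_stdGaussian (headVec N v))
  exact h.congr (ae_of_all _ fun θ => inner_headVec N θ v)

lemma integral_partialDot (v : SeqL2) (N : ℕ) : ∫ θ, partialDot θ v N ∂seqGaussian = 0 := by
  simp_rw [← inner_headVec]
  rw [integral_comp_headVec (integrable_inner_stdGaussian _), integral_inner_stdGaussian]

lemma partialDot_sub (θ : ℕ → ℝ) (v w : SeqL2) (N : ℕ) :
    partialDot θ (v - w) N = partialDot θ v N - partialDot θ w N := by
  simp only [partialDot, ← Finset.sum_sub_distrib]
  exact Finset.sum_congr rfl fun i _ => mul_sub _ _ _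

lemma partialDot_zero (θ : ℕ → ℝ) (N : ℕ) : partialDot θ 0 N = 0 :=
  Finset.sum_eq_zero fun _ _ => mul_zero _

lemma DotConverges.tendsto {θ : ℕ → ℝ} {v : SeqL2} (h : DotConverges θ v) :
    Tendsto (partialDot θ v) atTop (𝓝 (seqDot θ v)) := tendsto_nhds_limUnder h

lemma seqDot_eq_of_tendsto {θ : ℕ → ℝ} {v : SeqL2} {q : ℝ}
    (h : Tendsto (partialDot θ v) atTop (𝓝 q)) : seqDot θ v = q := h.limUnder_eq

lemma DotConverges.sub {θ : ℕ → ℝ} {v w : SeqL2} (hv : DotConverges θ v)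
    (hw : DotConverges θ w) : DotConverges θ (v - w) :=
  ⟨_, (hv.tendsto.sub hw.tendsto).congr fun N => (partialDot_sub θ v w N).symm⟩

lemma seqDot_sub {θ : ℕ → ℝ} {v w : SeqL2} (hv : DotConverges θ v) (hw : DotConverges θ w) :
    seqDot θ (v - w) = seqDot θ v - seqDot θ w :=
  seqDot_eq_of_tendsto <|
    (hv.tendsto.sub hw.tendsto).congr fun N => (partialDot_sub θ v w N).symm

lemma seqDot_zero (θ : ℕ → ℝ) : seqDot θ 0 = 0 :=
  seqDot_eq_of_tendsto (tendsto_const_nhds.congr fun N => (partialDot_zero θ N).symm)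

lemma measurable_seqDot (v : SeqL2) : Measurable fun θ => seqDot θ v :=
  (StronglyMeasurable.limUnder (l := atTop) (f := fun N θ => partialDot θ v N)
    fun N => (measurable_partialDot v N).stronglyMeasurable).measurable

/-- `E |⟨y, w⟩| ≤ √(2 log 2) ‖w‖`, as `|⟨y, w⟩|` is the maximum of two Gaussian variables. -/
lemma eLpNorm_inner_stdGaussian_le {E : Type*} [NormedAddCommGroup E] [InnerProductSpace ℝ E]
    [FiniteDimensional ℝ E] [MeasurableSpace E] [BorelSpace E] (w : E) :
    eLpNorm (fun y => inner ℝ y w) 1 (stdGaussian E) ≤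
      ENNReal.ofReal (‖w‖ * √(2 * Real.log 2)) := by
  have hint := integrable_inner_stdGaussian w
  rw [eLpNorm_one_eq_lintegral_enorm, ← ofReal_integral_norm_eq_lintegral_enorm hint]
  refine ENNReal.ofReal_le_ofReal ?_
  have h := integral_ciSup_inner_stdGaussian_le (norm_nonneg w)
    (fun b : Bool => if b then w else -w) (fun b => by cases b <;> simp)
  rw [Fintype.card_bool] at h
  refine le_trans (integral_mono hint.norm (integrable_ciSup fun b =>
    integrable_inner_stdGaussian _) fun y => ?_) h
  have h1 := le_ciSup_finite (fun b : Bool => (inner ℝ y (if b then w else -w) : ℝ)) true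
  have h2 := le_ciSup_finite (fun b : Bool => (inner ℝ y (if b then w else -w) : ℝ)) false
  simp only [Real.norm_eq_abs]
  refine abs_le'.2 ⟨by simpa using h1, by simpa using h2⟩

lemma eLpNorm_partialDot_le (v : SeqL2) (N : ℕ) :
    eLpNorm (fun θ => partialDot θ v N) 1 seqGaussian ≤
      ENNReal.ofReal (‖v‖ * √(2 * Real.log 2)) := by
  have h := eLpNorm_comp_measurePreserving (p := 1)
    (integrable_inner_stdGaussian (headVec N v)).1 (measurePreserving_headVec N)
  have h' : (fun y => inner ℝ y (headVec N v)) ∘ headVec N = fun θ => partialDot θ v N :=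
    funext fun θ => inner_headVec N θ v
  rw [h'] at h
  rw [h]
  refine (eLpNorm_inner_stdGaussian_le _).trans (ENNReal.ofReal_le_ofReal ?_)
  gcongr
  exact norm_headVec_le N v

/-- The first `N` terms of a square-summable sequence, followed by zeros. -/
noncomputable def truncSeq (N : ℕ) (v : SeqL2) : SeqL2 :=
  ∑ i ∈ Finset.range N, lp.single 2 i (v i)

lemma tendsto_norm_sub_truncSeq (v : SeqL2) :
    Tendsto (fun N => ‖v - truncSeq N v‖) atTop (𝓝 0) := by
  have h := (lp.hasSum_single (by norm_num) v).tendsto_sum_nat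
  simpa [truncSeq] using (h.const_sub v).norm

lemma truncSeq_apply (N : ℕ) (v : SeqL2) (i : ℕ) :
    truncSeq N v i = if i < N then v i else 0 := by
  simp only [truncSeq, lp.coeFn_sum, Finset.sum_apply, lp.single_apply, Pi.single_apply]
  simp

lemma partialDot_truncSeq (θ : ℕ → ℝ) (v : SeqL2) {N M : ℕ} (h : N ≤ M) :
    partialDot θ (truncSeq N v) M = partialDot θ v N := by
  simp only [partialDot, truncSeq_apply, mul_ite, mul_zero]
  rw [← Finset.sum_filter]
  refine Finset.sum_congr ?_ fun _ _ => rfl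
  ext i
  simp only [Finset.mem_filter, Finset.mem_range]
  omega

lemma eLpNorm_partialDot_sub_seqDot_le {v : SeqL2} (hv : ∀ᵐ θ ∂seqGaussian, DotConverges θ v)
    (N : ℕ) : eLpNorm ((fun θ => partialDot θ v N) - fun θ => seqDot θ v) 1 seqGaussian ≤
      ENNReal.ofReal (‖v - truncSeq N v‖ * √(2 * Real.log 2)) := by
  rw [eLpNorm_sub_comm]
  refine (Lp.eLpNorm_lim_le_liminf_eLpNorm
    (f := fun M θ => partialDot θ v M - partialDot θ v N)
    (fun M => ((integrable_partialDot v M).sub (integrable_partialDot v N)).1) _ ?_).trans ?_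
  · filter_upwards [hv] with θ hθ
    exact hθ.tendsto.sub_const _
  · refine liminf_le_of_frequently_le' (Eventually.frequently ?_)
    filter_upwards [eventually_ge_atTop N] with M hM
    have : (fun θ => partialDot θ v M - partialDot θ v N) =
        fun θ => partialDot θ (v - truncSeq N v) M := by
      ext θ
      rw [partialDot_sub, partialDot_truncSeq θ v hM]
    rw [this]
    exact eLpNorm_partialDot_le _ M

lemma tendsto_eLpNorm_partialDot_sub_seqDot {v : SeqL2}
    (hv : ∀ᵐ θ ∂seqGaussian, DotConverges θ v) :
    Tendsto (fun N => eLpNorm ((fun θ => partialDot θ v N) - fun θ => seqDot θ v) 1 seqGaussian)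
      atTop (𝓝 0) := by
  have h : Tendsto (fun N => ENNReal.ofReal (‖v - truncSeq N v‖ * √(2 * Real.log 2)))
      atTop (𝓝 0) := by
    have := ENNReal.tendsto_ofReal ((tendsto_norm_sub_truncSeq v).mul_const √(2 * Real.log 2))
    simpa using this
  exact tendsto_of_tendsto_of_tendsto_of_le_of_le tendsto_const_nhds h (fun _ => zero_le)
    (eLpNorm_partialDot_sub_seqDot_le hv)

lemma integrable_seqDot {v : SeqL2} (hv : ∀ᵐ θ ∂seqGaussian, DotConverges θ v) :
    Integrable (fun θ => seqDot θ v) seqGaussian := by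
  have h : MemLp ((fun θ => partialDot θ v 0) - fun θ => seqDot θ v) 1 seqGaussian :=
    ⟨((measurable_partialDot v 0).sub (measurable_seqDot v)).aestronglyMeasurable,
      (eLpNorm_partialDot_sub_seqDot_le hv 0).trans_lt ENNReal.ofReal_lt_top⟩
  have h' := (memLp_one_iff_integrable.1 h).neg
  refine h'.congr (ae_of_all _ fun θ => ?_)
  simp [partialDot]

lemma integral_seqDot {v : SeqL2} (hv : ∀ᵐ θ ∂seqGaussian, DotConverges θ v) :
    ∫ θ, seqDot θ v ∂seqGaussian = 0 := by
  have h := tendsto_integral_of_L1' _ (integrable_seqDot hv).1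
    (Eventually.of_forall fun N => integrable_partialDot v N)
    (tendsto_eLpNorm_partialDot_sub_seqDot hv)
  simp only [integral_partialDot] at h
  exact tendsto_nhds_unique h tendsto_const_nhds

/-! ### The martingale of partial sums -/

/-- The filtration on `ℝ^ℕ` generated by the coordinates. -/
noncomputable def coordFiltration : Filtration ℕ (MeasurableSpace.pi : MeasurableSpace (ℕ → ℝ)) :=
  Filtration.natural (fun i (θ : ℕ → ℝ) => θ i)
    fun i => (measurable_pi_apply i).stronglyMeasurable

lemma stronglyMeasurable_coord_coordFiltration {i n : ℕ} (h : i ≤ n) :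
    StronglyMeasurable[coordFiltration n] fun θ : ℕ → ℝ => θ i :=
  (Filtration.stronglyAdapted_natural (u := fun i (θ : ℕ → ℝ) => θ i)
    fun i => (measurable_pi_apply i).stronglyMeasurable).stronglyMeasurable_le h

lemma iSup_coordFiltration :
    ⨆ n, (coordFiltration n : MeasurableSpace (ℕ → ℝ)) = MeasurableSpace.pi := by
  refine le_antisymm (iSup_le fun n => coordFiltration.le n) (iSup_le fun i => ?_)
  exact (stronglyMeasurable_coord_coordFiltration le_rfl).measurable.comap_le.trans
    (le_iSup (fun n => (coordFiltration n : MeasurableSpace (ℕ → ℝ))) i)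

lemma martingale_partialDot (v : SeqL2) :
    Martingale (fun n θ => partialDot θ v (n + 1)) coordFiltration seqGaussian := by
  refine martingale_of_condExp_sub_eq_zero_nat (fun n => ?_)
    (fun n => integrable_partialDot v _) fun n => ?_
  · have : (fun θ => partialDot θ v (n + 1)) = ∑ i ∈ Finset.range (n + 1), fun θ => θ i * v i := by
      ext θ; simp [partialDot]
    rw [this]
    refine Finset.stronglyMeasurable_sum _ fun i hi => ?_
    exact (stronglyMeasurable_coord_coordFiltration
      (Nat.lt_succ_iff.1 (Finset.mem_range.1 hi))).mul_const _
  · have hincr : ((fun θ => partialDot θ v (n + 1 + 1)) - fun θ => partialDot θ v (n + 1)) =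
        v (n + 1) • fun θ : ℕ → ℝ => θ (n + 1) := by
      ext θ; simp [partialDot, Finset.sum_range_succ _ (n + 1), mul_comm]
    have hind : iIndepFun (fun i (θ : ℕ → ℝ) => θ i) seqGaussian :=
      iIndepFun_infinitePi (P := fun _ : ℕ => gaussianReal 0 1) (X := fun _ x => x)
        fun _ => measurable_id
    have hcond := hind.condExp_natural_ae_eq_of_lt
      (fun i => (measurable_pi_apply i).stronglyMeasurable) (Nat.lt_succ_self n)
    have hmean : ∫ θ : ℕ → ℝ, θ (n + 1) ∂seqGaussian = 0 := by
      have h := Measure.infinitePi_map_eval (fun _ : ℕ => gaussianReal 0 1) (n + 1)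
      rw [← integral_id_gaussianReal (μ := 0) (v := 1), ← h,
        integral_map (measurable_pi_apply _).aemeasurable (by fun_prop)]
      rfl
    rw [hincr]
    filter_upwards [condExp_smul (μ := seqGaussian) (v (n + 1)) (fun θ : ℕ → ℝ => θ (n + 1))
      (coordFiltration n), hcond] with θ h1 h2
    rw [h1, Pi.smul_apply]
    refine (congrArg (v (n + 1) • ·) h2).trans ?_
    simp [hmean]

/-- The truncations of the series are the conditional expectations of its sum. -/
lemma partialDot_ae_eq_condExp {v : SeqL2} (hv : ∀ᵐ θ ∂seqGaussian, DotConverges θ v) (n : ℕ) :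
    (fun θ => partialDot θ v (n + 1)) =ᵐ[seqGaussian]
      seqGaussian[fun θ => seqDot θ v | coordFiltration n] :=
  (martingale_partialDot v).eq_condExp_of_tendsto_eLpNorm (integrable_seqDot hv)
    ((tendsto_eLpNorm_partialDot_sub_seqDot hv).comp (tendsto_add_atTop_nat 1)) n

end Series

/-! ### Suprema of the Gaussian series over compact sets -/

section SeriesSup

/-- The supremum over `K` of the series truncated after `N` terms. -/
noncomputable def truncSup (K : Set SeqL2) (N : ℕ) (θ : ℕ → ℝ) : ℝ :=
  supportFn ((fun v : SeqL2 => headVec N v) '' K) (headVec N θ)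

lemma truncSup_eq_sSup (K : Set SeqL2) (N : ℕ) (θ : ℕ → ℝ) :
    truncSup K N θ = sSup ((fun v => partialDot θ v N) '' K) := by
  simp only [truncSup, supportFn, Set.image_image, inner_headVec]

lemma isCompact_headVec_image {K : Set SeqL2} (hK : IsCompact K) (N : ℕ) :
    IsCompact ((fun v : SeqL2 => headVec N v) '' K) := hK.image (continuous_headVec N)

lemma norm_le_of_mem_headVec_image {K : Set SeqL2} {ε : ℝ} (hKε : ∀ v ∈ K, ‖v‖ ≤ ε) (N : ℕ) :
    ∀ s ∈ (fun v : SeqL2 => headVec N v) '' K, ‖s‖ ≤ ε := by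
  rintro _ ⟨v, hv, rfl⟩
  exact (norm_headVec_le N v).trans (hKε v hv)

lemma partialDot_le_truncSup {K : Set SeqL2} (hK : IsCompact K) {v : SeqL2} (hv : v ∈ K) (N : ℕ)
    (θ : ℕ → ℝ) : partialDot θ v N ≤ truncSup K N θ := by
  rw [← inner_headVec]
  exact inner_le_supportFn (isCompact_headVec_image hK N) _ ⟨v, hv, rfl⟩

lemma measurable_truncSup {K : Set SeqL2} (hK : IsCompact K) (hne : K.Nonempty) (N : ℕ) :
    Measurable (truncSup K N) :=
  (continuous_supportFn (isCompact_headVec_image hK N) (hne.image _)).measurable.comp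
    (measurable_headVec N)

lemma integrable_truncSup {K : Set SeqL2} (hK : IsCompact K) (hne : K.Nonempty) (N : ℕ) :
    Integrable (truncSup K N) seqGaussian :=
  (measurePreserving_headVec N).integrable_comp_of_integrable
    (integrable_supportFn (isCompact_headVec_image hK N) (hne.image _))

/-- The truncated supremum over `K` is at most any bound valid on a dense subset of `K`. -/
lemma truncSup_le_of_dense {K T : Set SeqL2} (hne : K.Nonempty) (hT : K ⊆ closure T) {N : ℕ}
    {θ : ℕ → ℝ} {c : ℝ} (h : ∀ v ∈ T, partialDot θ v N ≤ c) : truncSup K N θ ≤ c := by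
  have hcont : Continuous fun v : SeqL2 => partialDot θ v N := by
    simp_rw [← inner_headVec]
    exact continuous_const.inner (continuous_headVec N)
  rw [truncSup_eq_sSup]
  refine csSup_le (hne.image _) ?_
  rintro _ ⟨v, hv, rfl⟩
  exact closure_minimal (s := T) (fun w hw => h w hw) (isClosed_le hcont continuous_const) (hT hv)

section Transfer

variable {P : Type*} [Fintype P] [Nonempty P] {K : P → Set SeqL2} {g : P → (ℕ → ℝ) → ℝ} {ε : ℝ}

lemma integral_ciSup_sub_integral_le_of_tendsto_truncSup (hK : ∀ p, IsCompact (K p))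
    (hne : ∀ p, (K p).Nonempty) (hε : 0 ≤ ε) (hKε : ∀ p, ∀ v ∈ K p, ‖v‖ ≤ ε)
    (hg : ∀ p, Integrable (g p) seqGaussian)
    (hlim : ∀ p, Tendsto (fun n => eLpNorm (truncSup (K p) (n + 1) - g p) 1 seqGaussian)
      atTop (𝓝 0)) :
    ∫ θ, (⨆ p, (g p θ - ∫ θ', g p θ' ∂seqGaussian)) ∂seqGaussian ≤
      Real.pi / 2 * (ε * √(2 * Real.log (Fintype.card P))) := by
  refine integral_ciSup_deviation_le_of_tendsto
    (fun p n => integrable_truncSup (hK p) (hne p) (n + 1)) hg hlim fun n => ?_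
  have hc := fun p => isCompact_headVec_image (hK p) (n + 1)
  have hi := fun p => integrable_supportFn (hc p) ((hne p).image _)
  have h := integral_ciSup_supportFn_sub_integral_le hc (fun p => (hne p).image _) hε
    fun p => norm_le_of_mem_headVec_image (hKε p) (n + 1)
  have hdev : Integrable (fun x => ⨆ p, (supportFn ((fun v : SeqL2 => headVec (n + 1) v) '' K p) x -
      ∫ y, supportFn ((fun v : SeqL2 => headVec (n + 1) v) '' K p) y ∂(stdGaussian _)))
      (stdGaussian _) := integrable_ciSup fun p => (hi p).sub (integrable_const _)
  rw [← integral_comp_headVec hdev] at h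
  simp only [truncSup, integral_comp_headVec (hi _)]
  exact h

lemma integral_ciSup_integral_sub_le_of_tendsto_truncSup (hK : ∀ p, IsCompact (K p))
    (hne : ∀ p, (K p).Nonempty) (hε : 0 ≤ ε) (hKε : ∀ p, ∀ v ∈ K p, ‖v‖ ≤ ε)
    (hg : ∀ p, Integrable (g p) seqGaussian)
    (hlim : ∀ p, Tendsto (fun n => eLpNorm (truncSup (K p) (n + 1) - g p) 1 seqGaussian)
      atTop (𝓝 0)) :
    ∫ θ, (⨆ p, (∫ θ', g p θ' ∂seqGaussian - g p θ)) ∂seqGaussian ≤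
      Real.pi / 2 * (ε * √(2 * Real.log (Fintype.card P))) := by
  have hlim' : ∀ p, Tendsto (fun n => eLpNorm (-truncSup (K p) (n + 1) - -g p) 1 seqGaussian)
      atTop (𝓝 0) := fun p => (hlim p).congr fun n => by
    rw [← eLpNorm_neg, neg_sub', sub_eq_add_neg]
  have key := integral_ciSup_deviation_le_of_tendsto (B := Real.pi / 2 *
    (ε * √(2 * Real.log (Fintype.card P)))) (f := fun p n => -truncSup (K p) (n + 1))
    (g := fun p => -g p)
    (fun p n => (integrable_truncSup (hK p) (hne p) (n + 1)).neg) (fun p => (hg p).neg) hlim' ?_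
  · simpa only [Pi.neg_apply, integral_neg, sub_neg_eq_add, neg_add_eq_sub] using key
  intro n
  have hc := fun p => isCompact_headVec_image (hK p) (n + 1)
  have hi := fun p => integrable_supportFn (hc p) ((hne p).image _)
  have h := integral_ciSup_integral_sub_supportFn_le hc (fun p => (hne p).image _) hε
    fun p => norm_le_of_mem_headVec_image (hKε p) (n + 1)
  have hdev : Integrable (fun x =>
      ⨆ p, (∫ y, supportFn ((fun v : SeqL2 => headVec (n + 1) v) '' K p) y ∂(stdGaussian _) -
        supportFn ((fun v : SeqL2 => headVec (n + 1) v) '' K p) x))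
      (stdGaussian _) := integrable_ciSup fun p => (integrable_const _).sub (hi p)
  rw [← integral_comp_headVec hdev] at h
  simp only [Pi.neg_apply, integral_neg, sub_neg_eq_add, neg_add_eq_sub, truncSup,
    integral_comp_headVec (hi _)]
  exact h

end Transfer

lemma ciSup_bool (f : Bool → ℝ) : ⨆ b, f b = max (f true) (f false) :=
  le_antisymm (ciSup_le fun b => by cases b <;> simp)
    (max_le (le_ciSup_finite f true) (le_ciSup_finite f false))

/-- For finitely many series the mean exceeds the maximum, on average, by a quantity that depends
on the norms of the vectors only, not on their number. -/
lemma integral_lower_deviation_ciSup_seqDot_le {ι : Type*} [Fintype ι] [Nonempty ι]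
    {d : ι → SeqL2} {R : ℝ} (hR : ∀ i, ‖d i‖ ≤ R)
    (hd : ∀ i, ∀ᵐ θ ∂seqGaussian, DotConverges θ (d i)) :
    ∫ θ, max (∫ θ', (⨆ i, seqDot θ' (d i)) ∂seqGaussian - ⨆ i, seqDot θ (d i)) 0 ∂seqGaussian ≤
      Real.pi / 2 * (R * √(2 * Real.log 2)) := by
  have hR0 : 0 ≤ R := (norm_nonneg _).trans (hR (Classical.arbitrary ι))
  -- the second member of the family is the constant `0`, so that the deviation is a positive part
  have h := integral_ciSup_integral_sub_le_of_tendsto_truncSup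
    (K := fun b : Bool => if b then Set.range d else {0})
    (g := fun b θ => if b then ⨆ i, seqDot θ (d i) else 0) (ε := R) ?_ ?_ hR0 ?_ ?_ ?_
  · rw [Fintype.card_bool] at h
    refine le_trans (le_of_eq (integral_congr_ae (ae_of_all _ fun θ => ?_))) h
    rw [ciSup_bool]
    simp
  · intro b
    cases b
    · simp
    · simpa using (Set.finite_range d).isCompact
  · intro b
    cases b
    · simp
    · simpa using Set.range_nonempty d
  · intro b
    cases b
    · simpa using hR0
    · simpa using hR
  · intro b
    cases b
    · simp
    · simpa using integrable_ciSup fun i => integrable_seqDot (hd i)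
  · intro b
    cases b
    · have h0 : ∀ n, truncSup {0} n = 0 := fun n => by
        ext θ
        rw [truncSup_eq_sSup]
        simp [partialDot_zero]
      simp only [Bool.false_eq_true, if_false, h0]
      exact tendsto_const_nhds.congr fun n => by
        rw [eq_comm]; convert! eLpNorm_zero using 2; ext; simp
    · have h1 : ∀ n, truncSup (Set.range d) n = fun θ => ⨆ i, partialDot θ (d i) n := fun n => by
        ext θ
        rw [truncSup_eq_sSup, ← Set.range_comp]
        rfl
      simp only [if_true, h1]
      exact (tendsto_eLpNorm_ciSup_sub (fun i n => integrable_partialDot (d i) n)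
        (fun i => integrable_seqDot (hd i))
        fun i => tendsto_eLpNorm_partialDot_sub_seqDot (hd i)).comp (tendsto_add_atTop_nat 1)

/-- A supremum of centred Gaussian series that is finite almost surely is integrable: a level that
is not exceeded with probability `1/2` bounds the means of all finite maxima, up to the uniform
bound on their lower deviation. -/
lemma integrable_ciSup_seqDot {d : ℕ → SeqL2} (h0 : d 0 = 0) {R : ℝ} (hR : ∀ i, ‖d i‖ ≤ R)
    (hd : ∀ i, ∀ᵐ θ ∂seqGaussian, DotConverges θ (d i))
    (hbdd : ∀ᵐ θ ∂seqGaussian, BddAbove (Set.range fun i => seqDot θ (d i))) :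
    Integrable (fun θ => ⨆ i, seqDot θ (d i)) seqGaussian := by
  set M : (ℕ → ℝ) → ℝ := fun θ => ⨆ i, seqDot θ (d i) with hM
  have hMm : Measurable M := Measurable.iSup fun i => measurable_seqDot (d i)
  set b := Real.pi / 2 * (R * √(2 * Real.log 2))
  set F : ℕ → (ℕ → ℝ) → ℝ := fun j θ => ⨆ i : Fin (j + 1), seqDot θ (d i) with hF
  have hFi : ∀ j, Integrable (F j) seqGaussian := fun j =>
    integrable_ciSup fun i => integrable_seqDot (hd i)
  have hF0 : ∀ j θ, 0 ≤ F j θ := fun j θ => by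
    have h := le_ciSup_finite (fun i : Fin (j + 1) => seqDot θ (d i)) 0
    simpa [h0, seqDot_zero] using h
  have hFM : ∀ᵐ θ ∂seqGaussian, ∀ j, F j θ ≤ M θ := by
    filter_upwards [hbdd] with θ hθ j
    exact ciSup_le fun i => le_ciSup hθ (i : ℕ)
  -- a level `t` that `M` exceeds with probability at most `1/2`
  obtain ⟨t, ht⟩ : ∃ t : ℕ, (1 / 2 : ℝ) ≤ seqGaussian.real {θ | M θ ≤ t} := by
    have hmono : Monotone fun t : ℕ => {θ | M θ ≤ t} := fun s t hst θ (hθ : M θ ≤ s) =>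
      hθ.trans (by exact_mod_cast hst)
    have hlim := tendsto_measure_iUnion_atTop (μ := seqGaussian) hmono
    have huniv : ⋃ t : ℕ, {θ | M θ ≤ t} = Set.univ :=
      Set.eq_univ_of_forall fun θ => Set.mem_iUnion.2 (exists_nat_ge (M θ))
    rw [huniv, measure_univ] at hlim
    have hlim' := (ENNReal.tendsto_toReal ENNReal.one_ne_top).comp hlim
    have hev := hlim'.eventually_const_lt (u := 1 / 2) (by norm_num)
    obtain ⟨t, ht⟩ := hev.exists
    exact ⟨t, ht.le⟩
  have hmean : ∀ j, ∫ θ, F j θ ∂seqGaussian ≤ t + 2 * b := by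
    intro j
    have hdev := integral_lower_deviation_ciSup_seqDot_le (d := fun i : Fin (j + 1) => d i)
      (fun i => hR i) fun i => hd i
    set e := ∫ θ, F j θ ∂seqGaussian with he
    by_contra! hlt
    have hb0 : 0 ≤ b := (integral_nonneg fun _ => le_max_right _ _).trans hdev
    have hS : MeasurableSet {θ | M θ ≤ t} := measurableSet_le hMm measurable_const
    have hint : Integrable (fun θ => max (e - F j θ) 0) seqGaussian :=
      ((integrable_const e).sub (hFi j)).pos_part
    have hle : ∫ θ, Set.indicator {θ | M θ ≤ t} (fun _ => e - t) θ ∂seqGaussian ≤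
        ∫ θ, max (e - F j θ) 0 ∂seqGaussian := by
      refine integral_mono_ae ((integrable_const _).indicator hS) hint ?_
      filter_upwards [hFM] with θ hθ
      by_cases hmem : M θ ≤ t
      · rw [Set.indicator_of_mem (show θ ∈ {θ | M θ ≤ t} from hmem)]
        exact le_max_of_le_left (by linarith [hθ j])
      · rw [Set.indicator_of_notMem (show θ ∉ {θ | M θ ≤ t} from hmem)]
        exact le_max_right _ _
    rw [integral_indicator_const _ hS, smul_eq_mul] at hle
    have : (1 / 2 : ℝ) * (e - t) ≤ b :=
      (mul_le_mul_of_nonneg_right ht (by linarith)).trans (hle.trans hdev)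
    linarith
  refine ⟨hMm.aestronglyMeasurable, ?_⟩
  have hlim : ∀ᵐ θ ∂seqGaussian, Tendsto (fun j => F j θ) atTop (𝓝 (M θ)) := by
    filter_upwards [hbdd, hFM] with θ hθ hle
    refine tendsto_order.2 ⟨fun a ha => ?_, fun a ha =>
      Eventually.of_forall fun j => (hle j).trans_lt ha⟩
    obtain ⟨i, hi⟩ := exists_lt_of_lt_ciSup ha
    filter_upwards [eventually_ge_atTop i] with j hj
    exact hi.trans_le
      (le_ciSup_finite (fun i : Fin (j + 1) => seqDot θ (d i)) ⟨i, Nat.lt_succ_of_le hj⟩)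
  have hfatou : eLpNorm M 1 seqGaussian ≤ ENNReal.ofReal (t + 2 * b) := by
    refine (Lp.eLpNorm_lim_le_liminf_eLpNorm (fun j => (hFi j).1) M hlim).trans
      (liminf_le_of_frequently_le' (Eventually.of_forall fun j => ?_).frequently)
    rw [eLpNorm_one_eq_lintegral_enorm, ← ofReal_integral_norm_eq_lintegral_enorm (hFi j)]
    refine ENNReal.ofReal_le_ofReal (le_trans (le_of_eq (integral_congr_ae
      (ae_of_all _ fun θ => ?_))) (hmean j))
    exact Real.norm_of_nonneg (hF0 j θ)
  rw [hasFiniteIntegral_iff_enorm, ← eLpNorm_one_eq_lintegral_enorm]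
  exact hfatou.trans_lt ENNReal.ofReal_lt_top

end SeriesSup

/-! ### Separability and convergence in mean of the suprema -/

section SeriesSupLimit

variable {K : Set SeqL2}

/-- The comparison behind separability: if `g` dominates the series on a
countable dense subset of `K`, its conditional expectations dominate the truncated suprema over the
whole of `K`, as the truncated series are continuous on `K`. -/
lemma truncSup_ae_le_condExp {T : Set SeqL2} (hne : K.Nonempty) (hTc : T.Countable)
    (hT : K ⊆ closure T) (hconv : ∀ v ∈ T, ∀ᵐ θ ∂seqGaussian, DotConverges θ v)
    {g : (ℕ → ℝ) → ℝ} (hg : Integrable g seqGaussian)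
    (hle : ∀ᵐ θ ∂seqGaussian, ∀ v ∈ T, seqDot θ v ≤ g θ) :
    ∀ᵐ θ ∂seqGaussian, ∀ n, truncSup K (n + 1) θ ≤ (seqGaussian[g | coordFiltration n]) θ := by
  rw [ae_all_iff]
  intro n
  have h : ∀ᵐ θ ∂seqGaussian, ∀ v ∈ T,
      partialDot θ v (n + 1) ≤ (seqGaussian[g | coordFiltration n]) θ := by
    rw [ae_ball_iff hTc]
    intro v hv
    have hmono := condExp_mono (m := coordFiltration n) (integrable_seqDot (hconv v hv)) hg
      (hle.mono fun θ h => h v hv)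
    filter_upwards [hmono, partialDot_ae_eq_condExp (hconv v hv) n] with θ h1 h2
    exact h2.trans_le h1
  filter_upwards [h] with θ hθ
  exact truncSup_le_of_dense hne hT hθ

/-- The supremum of the series over a compact set, when it is finite almost surely, is integrable,
and it is the limit in mean of the truncated suprema. -/
lemma integrable_and_tendsto_truncSup (hK : IsCompact K) (h0 : (0 : SeqL2) ∈ K)
    (hconv : ∀ᵐ θ ∂seqGaussian, ∀ v ∈ K, DotConverges θ v)
    (hbdd : ∀ᵐ θ ∂seqGaussian, BddAbove (seqDot θ '' K)) :
    Integrable (fun θ => sSup (seqDot θ '' K)) seqGaussian ∧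
      Tendsto (fun n => eLpNorm (truncSup K (n + 1) - fun θ => sSup (seqDot θ '' K)) 1 seqGaussian)
        atTop (𝓝 0) := by
  have hne : K.Nonempty := ⟨0, h0⟩
  have hconv' : ∀ v ∈ K, ∀ᵐ θ ∂seqGaussian, DotConverges θ v := fun v hv =>
    hconv.mono fun θ h => h v hv
  obtain ⟨R, hR⟩ := hK.isBounded.exists_norm_le
  -- an enumeration `d` of a dense subset of `K`, starting with `0`
  obtain ⟨T, hTK, hTc, hTd⟩ := hK.isSeparable.exists_countable_dense_subset
  have hTne : T.Nonempty := closure_nonempty_iff.1 (hne.mono hTd)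
  obtain ⟨d₀, rfl⟩ := hTc.exists_eq_range hTne
  set d : ℕ → SeqL2 := fun i => Nat.casesOn i 0 d₀ with hd
  have hdK : ∀ i, d i ∈ K := fun i => by
    cases i with
    | zero => exact h0
    | succ i => exact hTK (Set.mem_range_self i)
  have hdd : K ⊆ closure (Set.range d) := by
    refine hTd.trans (closure_mono ?_)
    rintro _ ⟨i, rfl⟩
    exact ⟨i + 1, rfl⟩
  set M : (ℕ → ℝ) → ℝ := fun θ => ⨆ i, seqDot θ (d i) with hM
  have hMm : Measurable M := Measurable.iSup fun i => measurable_seqDot (d i)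
  have hbddM : ∀ᵐ θ ∂seqGaussian, BddAbove (Set.range fun i => seqDot θ (d i)) := by
    filter_upwards [hbdd] with θ hθ
    refine hθ.mono ?_
    rintro _ ⟨i, rfl⟩
    exact ⟨d i, hdK i, rfl⟩
  have hMi : Integrable M seqGaussian := integrable_ciSup_seqDot rfl (fun i => hR _ (hdK i))
    (fun i => hconv' _ (hdK i)) hbddM
  set c : ℕ → (ℕ → ℝ) → ℝ := fun n => seqGaussian[M | coordFiltration n] with hc
  have hMF : StronglyMeasurable[⨆ n, (coordFiltration n : MeasurableSpace (ℕ → ℝ))] M := by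
    rw [iSup_coordFiltration]
    exact hMm.stronglyMeasurable
  have hle : ∀ᵐ θ ∂seqGaussian, ∀ n, truncSup K (n + 1) θ ≤ c n θ := by
    refine truncSup_ae_le_condExp hne (Set.countable_range d) hdd ?_ hMi ?_
    · rintro _ ⟨i, rfl⟩
      exact hconv' _ (hdK i)
    · filter_upwards [hbddM] with θ hθ
      rintro _ ⟨i, rfl⟩
      exact le_ciSup hθ i
  have hcM : ∀ᵐ θ ∂seqGaussian, Tendsto (fun n => c n θ) atTop (𝓝 (M θ)) :=
    hMi.tendsto_ae_condExp hMF
  have hcM1 : Tendsto (fun n => eLpNorm (c n - M) 1 seqGaussian) atTop (𝓝 0) :=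
    hMi.tendsto_eLpNorm_condExp hMF
  have hMsup : M =ᵐ[seqGaussian] fun θ => sSup (seqDot θ '' K) := by
    filter_upwards [hconv, hbdd, hle, hcM] with θ hθ hb hl hlim
    refine le_antisymm (ciSup_le fun i => le_csSup hb ⟨d i, hdK i, rfl⟩)
      (csSup_le (hne.image _) ?_)
    rintro _ ⟨v, hv, rfl⟩
    exact le_of_tendsto_of_tendsto' ((hθ v hv).tendsto.comp (tendsto_add_atTop_nat 1)) hlim
      fun n => (partialDot_le_truncSup hK hv (n + 1) θ).trans (hl n)
  have hnonneg : ∀ n θ, 0 ≤ truncSup K n θ := fun n θ => by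
    simpa [partialDot_zero] using partialDot_le_truncSup hK h0 n θ
  have hM0 : ∀ᵐ θ ∂seqGaussian, 0 ≤ M θ := by
    filter_upwards [hbddM] with θ hθ
    simpa [hd, seqDot_zero] using le_ciSup hθ 0
  have htrunc : ∀ᵐ θ ∂seqGaussian, Tendsto (fun n => truncSup K (n + 1) θ) atTop (𝓝 (M θ)) := by
    filter_upwards [hconv, hle, hcM] with θ hθ hl hlim
    refine tendsto_order.2 ⟨fun a ha => ?_, fun a ha => ?_⟩
    · obtain ⟨i, hi⟩ := exists_lt_of_lt_ciSup ha
      have h := (hθ _ (hdK i)).tendsto.comp (tendsto_add_atTop_nat 1)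
      filter_upwards [h.eventually_const_lt hi] with n hn
      exact hn.trans_le (partialDot_le_truncSup hK (hdK i) (n + 1) θ)
    · filter_upwards [hlim.eventually_lt_const ha] with n hn
      exact (hl n).trans_lt hn
  have htm := fun n => measurable_truncSup hK hne (n + 1)
  -- the part of the error below `M` is dominated by `M`, the part above by `|c n - M|`
  have hlow : Tendsto (fun n => eLpNorm (fun θ => M θ - min (truncSup K (n + 1) θ) (M θ)) 1
      seqGaussian) atTop (𝓝 0) := by
    simp only [eLpNorm_one_eq_lintegral_enorm]
    have h := tendsto_lintegral_of_dominated_convergence' (μ := seqGaussian)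
      (F := fun n θ => ‖M θ - min (truncSup K (n + 1) θ) (M θ)‖ₑ) (f := fun _ => 0)
      (fun θ => ‖M θ‖ₑ) (fun n => (hMm.sub ((htm n).min hMm)).enorm.aemeasurable) (fun n => ?_)
      hMi.2.ne ?_
    · simpa using h
    · filter_upwards [hM0] with θ hθ
      have h1 : 0 ≤ min (truncSup K (n + 1) θ) (M θ) := le_min (hnonneg _ _) hθ
      have h2 : min (truncSup K (n + 1) θ) (M θ) ≤ M θ := min_le_right _ _
      rw [enorm_le_iff_norm_le, Real.norm_of_nonneg hθ, Real.norm_of_nonneg (by linarith)]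
      linarith
    · filter_upwards [htrunc] with θ hθ
      have h := ((hθ.min (tendsto_const_nhds (x := M θ))).const_sub (M θ)).enorm
      simpa using h
  have hmain : Tendsto (fun n => eLpNorm (truncSup K (n + 1) - M) 1 seqGaussian) atTop (𝓝 0) := by
    have hsum := hlow.add hcM1
    rw [add_zero] at hsum
    refine tendsto_of_tendsto_of_tendsto_of_le_of_le tendsto_const_nhds hsum
      (fun _ => zero_le) fun n => ?_
    have hcm : AEStronglyMeasurable (c n - M) seqGaussian :=
      (integrable_condExp.sub hMi).aestronglyMeasurable
    have hlm : AEStronglyMeasurable (fun θ => M θ - min (truncSup K (n + 1) θ) (M θ))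
        seqGaussian := (hMm.sub ((htm n).min hMm)).aestronglyMeasurable
    refine le_trans (eLpNorm_mono_ae_real
      (g := (fun θ => ‖M θ - min (truncSup K (n + 1) θ) (M θ)‖) + fun θ => ‖(c n - M) θ‖) ?_)
      ((eLpNorm_add_le hlm.norm hcm.norm le_rfl).trans_eq ?_)
    · filter_upwards [hle] with θ hθ
      simp only [Pi.add_apply, Pi.sub_apply, Real.norm_eq_abs]
      rcases le_total (truncSup K (n + 1) θ) (M θ) with h | h
      · rw [min_eq_left h, abs_sub_comm]
        exact le_add_of_nonneg_right (abs_nonneg _)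
      · rw [min_eq_right h, abs_of_nonneg (sub_nonneg.2 h)]
        have := le_abs_self (c n θ - M θ)
        have := hθ n
        have := abs_nonneg (M θ - M θ)
        linarith
    · rw [eLpNorm_norm, eLpNorm_norm]
  refine ⟨hMi.congr hMsup, hmain.congr fun n => eLpNorm_congr_ae ?_⟩
  exact (EventuallyEq.refl _ _).sub hMsup

end SeriesSupLimit

/-! ### Cluster regrets -/

section ClusterRegret

lemma cluster_subset {Env 𝒳 𝒜 : Type*} (A : 𝒳 → Set 𝒜) (Q : Env → 𝒳 → 𝒜 → ℝ) (Θ : Set Env)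
    (x : 𝒳) : cluster A Q Θ x ⊆ A x := fun _ ⟨_, _, h⟩ => h.1

lemma csSup_image_sub_const {α : Type*} {s : Set α} (hs : s.Nonempty) {f : α → ℝ}
    (hf : BddAbove (f '' s)) (c : ℝ) : sSup ((fun a => f a - c) '' s) = sSup (f '' s) - c := by
  have h := (OrderIso.subRight c).map_csSup' (hs.image f) hf
  rw [Set.image_image] at h
  exact h.symm

/-- Deviation bounds with constant `π / 2` turn into the bounds for the maximal and the max-min
regret. -/
lemma regret_bounds_of_deviation {Ω 𝒳 : Type*} [MeasurableSpace Ω] {μ : Measure Ω}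
    [IsProbabilityMeasure μ] [Fintype 𝒳] [Nonempty 𝒳] {m : ℕ} (hm : 0 < m)
    {Y : 𝒳 → Fin m → Ω → ℝ} (hY : ∀ x l, Integrable (Y x l) μ) {G : 𝒳 → Fin m → ℝ}
    (hG : ∀ x l, G x l = ∫ ω, Y x l ω ∂μ) {ε : ℝ}
    (hup : ∫ ω, (⨆ p : 𝒳 × Fin m, (Y p.1 p.2 ω - ∫ ω', Y p.1 p.2 ω' ∂μ)) ∂μ ≤
      Real.pi / 2 * (ε * √(2 * Real.log (Fintype.card (𝒳 × Fin m)))))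
    (hlow : ∫ ω, (⨆ p : 𝒳 × Fin m, (∫ ω', Y p.1 p.2 ω' ∂μ - Y p.1 p.2 ω)) ∂μ ≤
      Real.pi / 2 * (ε * √(2 * Real.log (Fintype.card (𝒳 × Fin m))))) :
    Integrable (fun ω => ⨆ p : 𝒳 × Fin m, Y p.1 p.2 ω) μ ∧
      Integrable (fun ω => ⨆ x, ⨅ l, Y x l ω) μ ∧
      (∫ ω, (⨆ p : 𝒳 × Fin m, Y p.1 p.2 ω) ∂μ ≤ (⨆ p : 𝒳 × Fin m, G p.1 p.2) +
        Real.pi / 2 * √2 * ε * √(Real.log ((m : ℝ) * Fintype.card 𝒳))) ∧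
      (∫ ω, (⨆ x, ⨅ l, Y x l ω) ∂μ ≥ (⨆ x, ⨅ l, G x l) -
        Real.pi / 2 * √2 * ε * √(Real.log ((m : ℝ) * Fintype.card 𝒳))) := by
  have : Nonempty (Fin m) := ⟨⟨0, hm⟩⟩
  have hB : Real.pi / 2 * (ε * √(2 * Real.log (Fintype.card (𝒳 × Fin m)))) =
      Real.pi / 2 * √2 * ε * √(Real.log ((m : ℝ) * Fintype.card 𝒳)) := by
    rw [Real.sqrt_mul zero_le_two, Fintype.card_prod, Fintype.card_fin, Nat.cast_mul, mul_comm
      (Fintype.card 𝒳 : ℝ)]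
    ring
  rw [hB] at hup hlow
  simp only [hG]
  exact ⟨integrable_ciSup fun p : 𝒳 × Fin m => hY p.1 p.2,
    integrable_ciSup fun x => integrable_ciInf (hY x),
    integral_ciSup_le_of_deviation (Y := fun p : 𝒳 × Fin m => Y p.1 p.2)
      (fun p => hY p.1 p.2) hup,
    le_integral_ciSup_ciInf_of_deviation hY hlow⟩

lemma norm_sub_le_iSup_diam {E ι : Type*} [SeminormedAddCommGroup E] [Finite ι] {S : ι → Set E}
    (hS : ∀ i, IsCompact (S i)) (i : ι) {s t : E} (hs : s ∈ S i) (ht : t ∈ S i) :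
    ‖s - t‖ ≤ ⨆ j, Metric.diam (S j) := by
  rw [← dist_eq_norm]
  exact (Metric.dist_le_diam_of_mem (hS i).isBounded hs ht).trans
    (le_ciSup (f := fun j => Metric.diam (S j)) (Set.finite_range _).bddAbove i)

end ClusterRegret

theorem mainTheorem3 :
    ∃ C : ℝ, 0 < C ∧
    -- features in `ℝⁿ` with `n` finite
    (∀ (n : ℕ) (𝒳 : Type u) [Fintype 𝒳] [Nonempty 𝒳] (𝒜 : Type v) (m : ℕ), 0 < m →
      ∀ (A : 𝒳 → Set 𝒜) (φ : 𝒳 → 𝒜 → EuclideanSpace ℝ (Fin n))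
        (Q : EuclideanSpace ℝ (Fin n) → 𝒳 → 𝒜 → ℝ),
        (∀ θ x a, Q θ x a = inner ℝ θ (φ x a)) →
      ∀ (Θ : Fin m → Set (EuclideanSpace ℝ (Fin n))) (r : 𝒳 → Fin m → Set 𝒜),
        (∀ x l, r x l = cluster A Q (Θ l) x) →
        (∀ x l, IsCompact (φ x '' r x l)) →
      ∀ (rep : 𝒳 → Fin m → 𝒜), (∀ x l, rep x l ∈ r x l) →
      ∀ (Y : 𝒳 → Fin m → EuclideanSpace ℝ (Fin n) → ℝ),
        (∀ x l θ, Y x l θ = clusterRegret Q (r x l) x (rep x l) θ) →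
      ∀ (G : 𝒳 → Fin m → ℝ),
        (∀ x l, G x l = gaussianWidth (stdGaussian (EuclideanSpace ℝ (Fin n)))
          (fun u s => inner ℝ u s) (φ x '' r x l)) →
      ∀ (ε : ℝ), ε = (⨆ p : 𝒳 × Fin m, Metric.diam (φ p.1 '' r p.1 p.2)) →
        (∀ x l, Integrable (fun u => sSup ((fun s => (inner ℝ u s : ℝ)) '' (φ x '' r x l)))
          (stdGaussian (EuclideanSpace ℝ (Fin n)))) ∧
        Integrable (fun θ => ⨆ p : 𝒳 × Fin m, Y p.1 p.2 θ)
          (stdGaussian (EuclideanSpace ℝ (Fin n))) ∧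
        Integrable (fun θ => ⨆ x, ⨅ l, Y x l θ) (stdGaussian (EuclideanSpace ℝ (Fin n))) ∧
        (∫ θ, (⨆ p : 𝒳 × Fin m, Y p.1 p.2 θ) ∂(stdGaussian (EuclideanSpace ℝ (Fin n))) ≤
          (⨆ p : 𝒳 × Fin m, G p.1 p.2) + C * ε * √(Real.log ((m : ℝ) * Fintype.card 𝒳))) ∧
        (∫ θ, (⨆ x, ⨅ l, Y x l θ) ∂(stdGaussian (EuclideanSpace ℝ (Fin n))) ≥
          (⨆ x, ⨅ l, G x l) - C * ε * √(Real.log ((m : ℝ) * Fintype.card 𝒳)))) ∧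
    -- `n = ∞`: square-summable features
    (∀ (𝒳 : Type u) [Fintype 𝒳] [Nonempty 𝒳] (𝒜 : Type v) (m : ℕ), 0 < m →
      ∀ (A : 𝒳 → Set 𝒜) (φ : 𝒳 → 𝒜 → SeqL2) (Q : (ℕ → ℝ) → 𝒳 → 𝒜 → ℝ),
        (∀ θ x a, Q θ x a = seqDot θ (φ x a)) →
        -- almost every environment has well-defined values
        (∀ᵐ θ ∂seqGaussian, ∀ x, ∀ a ∈ A x, DotConverges θ (φ x a)) →
      ∀ (Θ : Fin m → Set (ℕ → ℝ)),
        (∀ l, ∀ θ ∈ Θ l, ∀ x, ∀ a ∈ A x, DotConverges θ (φ x a)) →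
      ∀ (r : 𝒳 → Fin m → Set 𝒜),
        (∀ x l, r x l = cluster A Q (Θ l) x) →
        (∀ x l, IsCompact (φ x '' r x l)) →
        -- the maxima over clusters are finite
        (∀ᵐ θ ∂seqGaussian, ∀ x l, BddAbove (Q θ x '' r x l)) →
      ∀ (rep : 𝒳 → Fin m → 𝒜), (∀ x l, rep x l ∈ r x l) →
      ∀ (Y : 𝒳 → Fin m → (ℕ → ℝ) → ℝ),
        (∀ x l θ, Y x l θ = clusterRegret Q (r x l) x (rep x l) θ) →
      ∀ (G : 𝒳 → Fin m → ℝ),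
        (∀ x l, G x l = gaussianWidth seqGaussian seqDot (φ x '' r x l)) →
      ∀ (ε : ℝ), ε = (⨆ p : 𝒳 × Fin m, Metric.diam (φ p.1 '' r p.1 p.2)) →
        (∀ x l, Integrable (fun u => sSup (seqDot u '' (φ x '' r x l))) seqGaussian) ∧
        Integrable (fun θ => ⨆ p : 𝒳 × Fin m, Y p.1 p.2 θ) seqGaussian ∧
        Integrable (fun θ => ⨆ x, ⨅ l, Y x l θ) seqGaussian ∧
        (∫ θ, (⨆ p : 𝒳 × Fin m, Y p.1 p.2 θ) ∂seqGaussian ≤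
          (⨆ p : 𝒳 × Fin m, G p.1 p.2) + C * ε * √(Real.log ((m : ℝ) * Fintype.card 𝒳))) ∧
        (∫ θ, (⨆ x, ⨅ l, Y x l θ) ∂seqGaussian ≥
          (⨆ x, ⨅ l, G x l) - C * ε * √(Real.log ((m : ℝ) * Fintype.card 𝒳)))) := by
  refine ⟨Real.pi / 2 * √2, by positivity, ?_, ?_⟩
  · intro n 𝒳 _ _ 𝒜 m hm A φ Q hQ Θ r _ hcomp rep hrep Y hY G hG ε hε
    have : Nonempty (Fin m) := ⟨⟨0, hm⟩⟩
    have hε0 : 0 ≤ ε := hε ▸ Real.iSup_nonneg fun _ => Metric.diam_nonneg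
    have hne : ∀ x l, (φ x '' r x l).Nonempty := fun x l => ⟨_, rep x l, hrep x l, rfl⟩
    have hwidth : ∀ x l, Integrable (supportFn (φ x '' r x l))
        (stdGaussian (EuclideanSpace ℝ (Fin n))) :=
      fun x l => integrable_supportFn (hcomp x l) (hne x l)
    refine ⟨hwidth, ?_⟩
    -- the regret is the support function of the features recentred at the representative
    set K : 𝒳 × Fin m → Set (EuclideanSpace ℝ (Fin n)) := fun p =>
      (fun s => s - φ p.1 (rep p.1 p.2)) '' (φ p.1 '' r p.1 p.2) with hK
    have hKc : ∀ p, IsCompact (K p) := fun p => (hcomp p.1 p.2).image (by fun_prop)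
    have hKne : ∀ p, (K p).Nonempty := fun p => (hne p.1 p.2).image _
    have hKε : ∀ p, ∀ s ∈ K p, ‖s‖ ≤ ε := by
      rintro p _ ⟨s, hs, rfl⟩
      rw [hε]
      exact norm_sub_le_iSup_diam (S := fun p : 𝒳 × Fin m => φ p.1 '' r p.1 p.2)
        (fun p => hcomp p.1 p.2) p hs ⟨_, hrep p.1 p.2, rfl⟩
    have hYK : ∀ x l, Y x l = supportFn (K (x, l)) := by
      intro x l
      ext θ
      simp only [hY, clusterRegret, supportFn, hK, hQ, Set.image_image, inner_sub_right]
    have hYG : ∀ x l θ, supportFn (K (x, l)) θ =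
        supportFn (φ x '' r x l) θ - inner ℝ θ (φ x (rep x l)) := by
      intro x l θ
      rw [supportFn, supportFn, hK, Set.image_image]
      simp only [inner_sub_right]
      exact csSup_image_sub_const (hne x l) (bddAbove_inner_image (hcomp x l) θ) _
    have hYi : ∀ x l, Integrable (Y x l) (stdGaussian (EuclideanSpace ℝ (Fin n))) :=
      fun x l => hYK x l ▸ integrable_supportFn (hKc (x, l)) (hKne (x, l))
    refine regret_bounds_of_deviation hm hYi (fun x l => ?_) ?_ ?_
    · rw [hYK, hG, gaussianWidth]
      simp only [hYG]
      rw [integral_sub (hwidth x l) (integrable_inner_stdGaussian _), integral_inner_stdGaussian,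
        sub_zero]
      rfl
    · simp only [hYK]
      exact integral_ciSup_supportFn_sub_integral_le hKc hKne hε0 hKε
    · simp only [hYK]
      exact integral_ciSup_integral_sub_supportFn_le hKc hKne hε0 hKε
  · intro 𝒳 _ _ 𝒜 m hm A φ Q hQ hconv Θ _ r hr hcomp hbdd rep hrep Y hY G hG ε hε
    have : Nonempty (Fin m) := ⟨⟨0, hm⟩⟩
    have hε0 : 0 ≤ ε := hε ▸ Real.iSup_nonneg fun _ => Metric.diam_nonneg
    have hne : ∀ x l, (φ x '' r x l).Nonempty := fun x l => ⟨_, rep x l, hrep x l, rfl⟩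
    have hconv_r : ∀ᵐ θ ∂seqGaussian, ∀ x l, ∀ a ∈ r x l, DotConverges θ (φ x a) := by
      filter_upwards [hconv] with θ hθ x l a ha
      rw [hr] at ha
      exact hθ x a (cluster_subset _ _ _ _ ha)
    have hbdd_r : ∀ᵐ θ ∂seqGaussian, ∀ x l, BddAbove (seqDot θ '' (φ x '' r x l)) := by
      filter_upwards [hbdd] with θ hθ x l
      have h := hθ x l
      rwa [show Q θ x = fun a => seqDot θ (φ x a) from funext (hQ θ x),
        ← Set.image_image (seqDot θ) (φ x)] at h
    have hrepconv : ∀ x l, ∀ᵐ θ ∂seqGaussian, DotConverges θ (φ x (rep x l)) := fun x l =>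
      hconv_r.mono fun θ h => h x l _ (hrep x l)
    -- features recentred at the representative
    set K : 𝒳 × Fin m → Set SeqL2 := fun p =>
      (fun s => s - φ p.1 (rep p.1 p.2)) '' (φ p.1 '' r p.1 p.2) with hK
    have hKc : ∀ p, IsCompact (K p) := fun p => (hcomp p.1 p.2).image (by fun_prop)
    have hK0 : ∀ p, (0 : SeqL2) ∈ K p := fun p =>
      ⟨_, ⟨_, hrep p.1 p.2, rfl⟩, sub_self _⟩
    have hKε : ∀ p, ∀ s ∈ K p, ‖s‖ ≤ ε := by
      rintro p _ ⟨s, hs, rfl⟩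
      rw [hε]
      exact norm_sub_le_iSup_diam (S := fun p : 𝒳 × Fin m => φ p.1 '' r p.1 p.2)
        (fun p => hcomp p.1 p.2) p hs ⟨_, hrep p.1 p.2, rfl⟩
    have himage : ∀ᵐ θ ∂seqGaussian, ∀ x l, seqDot θ '' K (x, l) =
        (fun a => seqDot θ (φ x a) - seqDot θ (φ x (rep x l))) '' r x l := by
      filter_upwards [hconv_r] with θ hθ x l
      rw [hK, Set.image_image, Set.image_image]
      exact Set.image_congr fun a ha => seqDot_sub (hθ x l a ha) (hθ x l _ (hrep x l))
    have hKsup : ∀ᵐ θ ∂seqGaussian, ∀ x l, sSup (seqDot θ '' K (x, l)) =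
        sSup (seqDot θ '' (φ x '' r x l)) - seqDot θ (φ x (rep x l)) := by
      filter_upwards [himage, hbdd_r] with θ hθ hb x l
      rw [hθ, Set.image_image]
      exact csSup_image_sub_const ⟨_, hrep x l⟩ (by simpa only [Set.image_image] using hb x l) _
    have hYK : ∀ x l, (fun θ => sSup (seqDot θ '' K (x, l))) =ᵐ[seqGaussian] Y x l := by
      intro x l
      filter_upwards [himage] with θ hθ
      simp only [hY, clusterRegret, hQ, hθ]
    have hKconv : ∀ p, ∀ᵐ θ ∂seqGaussian, ∀ v ∈ K p, DotConverges θ v := by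
      intro p
      filter_upwards [hconv_r] with θ hθ
      rintro _ ⟨_, ⟨a, ha, rfl⟩, rfl⟩
      exact (hθ p.1 p.2 a ha).sub (hθ p.1 p.2 _ (hrep p.1 p.2))
    have hKbdd : ∀ p, ∀ᵐ θ ∂seqGaussian, BddAbove (seqDot θ '' K p) := by
      intro p
      filter_upwards [himage, hbdd_r] with θ hθ hb
      obtain ⟨c, hc⟩ := hb p.1 p.2
      rw [show K p = K (p.1, p.2) from rfl, hθ]
      refine ⟨c - seqDot θ (φ p.1 (rep p.1 p.2)), ?_⟩
      rintro _ ⟨a, ha, rfl⟩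
      exact sub_le_sub_right (hc ⟨_, ⟨a, ha, rfl⟩, rfl⟩) _
    have hlim := fun p => integrable_and_tendsto_truncSup (hKc p) (hK0 p) (hKconv p) (hKbdd p)
    have hYi : ∀ x l, Integrable (Y x l) seqGaussian := fun x l =>
      (hlim (x, l)).1.congr (hYK x l)
    have hrepi : ∀ x l, Integrable (fun θ => seqDot θ (φ x (rep x l))) seqGaussian :=
      fun x l => integrable_seqDot (hrepconv x l)
    have hwidth : ∀ x l, (fun u => sSup (seqDot u '' (φ x '' r x l))) =ᵐ[seqGaussian]
        Y x l + fun θ => seqDot θ (φ x (rep x l)) := by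
      intro x l
      filter_upwards [hKsup, hYK x l] with θ h1 h2
      rw [Pi.add_apply, ← h2, h1, sub_add_cancel]
    refine ⟨fun x l => ((hYi x l).add (hrepi x l)).congr (hwidth x l).symm, ?_⟩
    have hYlim : ∀ p : 𝒳 × Fin m, Tendsto
        (fun n => eLpNorm (truncSup (K p) (n + 1) - Y p.1 p.2) 1 seqGaussian) atTop (𝓝 0) :=
      fun p => (hlim p).2.congr fun n =>
        eLpNorm_congr_ae ((EventuallyEq.refl _ _).sub (hYK p.1 p.2))
    refine regret_bounds_of_deviation hm hYi (fun x l => ?_) ?_ ?_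
    · rw [hG, gaussianWidth, integral_congr_ae (hwidth x l),
        integral_add' (hYi x l) (hrepi x l), integral_seqDot (hrepconv x l), add_zero]
    · exact integral_ciSup_sub_integral_le_of_tendsto_truncSup hKc (fun p => ⟨0, hK0 p⟩) hε0 hKε
        (fun p => hYi p.1 p.2) hYlim
    · exact integral_ciSup_integral_sub_le_of_tendsto_truncSup hKc (fun p => ⟨0, hK0 p⟩) hε0 hKε
        (fun p => hYi p.1 p.2) hYlim
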